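/- **Theorem 3.1.** Let $k$ be a commutative ring, $A$ a $k$-algebra (associative, unital), and let $(H,s,t)$ be an $A^e$-ring: a $k$-algebra $H$ with an algebra map $s:A\to H$ and an anti-algebra map $t:A\to H$ such that $s(a)t(b)=t(b)s(a)$ for all $a,b\in A$. *Conventions.* View $H$ as an $(A,A)$-bimodule by $a\cdot h=s(a)h$, $h\cdot a=t(a)h$, so that $H\otimes_A H$ is the quotient of $H\otimes_k H$ by the relations $t(a)g\otimes h=g\otimes s(a)h$, with bimodule structure $a\cdot(g\otimes h)\cdot b=s(a)g\otimes t(b)h$. Let $\Gamma=H\times_A H$ be the set of all $\sum g^1\otimes g^2\in H\otimes_AH$ with $\sum g^1t(a)\otimes g^2=\sum g^1\otimes g^2s(a)$ for all $a\in A$; it is an $A^e$-ring with product $(\sum g^1\otimes g^2)(\sum h^1\otimes h^2)=\sum g^1h^1\otimes g^2h^2$, unit $1\otimes1$, source $a\mapsto s(a)\otimes1$ and target $b\mapsto1\otimes t(b)$. The algebra $\mathrm{End}(A)$ of $k$-linear endomorphisms of $A$ is an $A^e$-ring with $s(a)(x)=ax$, $t(b)(x)=xb$, and hence an $(A,A)$-bimodule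 by $(a\cdot f\cdot b)(x)=af(x)b$. For $A^e$-bimodules $M,N$ (where $A^e=A\otimes_k\bar A$, $\bar A=A^{op}$), $M\times_AN$ is the $A^e$-bimodule of all $\sum m\otimes n$ in the quotient $M\otimes_A N$ of $M\otimes_k N$ by the relations $\bar a m\otimes n=m\otimes an$ that satisfy $\sum m\bar b\otimes n=\sum m\otimes nb$ for all $b\in A$, with actions $(a\otimes\bar a')(\sum m\otimes n)(b\otimes\bar b')=\sum amb\otimes\bar a'n\bar b'$. The $A^e$-ring $H$ is an $A^e$-bimodule by $a\cdot h\cdot b=s(a)hs(b)$, $\bar a\cdot h\cdot\bar b=t(a)ht(b)$. Write $\Delta(h)=h_{(1)}\otimes h_{(2)}$. Then the following four sets of structures on $(H,s,t)$ are in bijection with each other. (1) *Bialgebroid structures* $(\Delta,\epsilon)$: bimodule maps $\Delta:H\to H\otimes_AH$ and $\epsilon:H\to A$ such that $(H,\Delta,\epsilon)$ is an $A$-coring (coassociative and counital), $\mathrm{Im}\,\Delta\subseteq\Gamma$ and the corestriction $\Delta:H\to\Gamma$ is an algebra map, $\epsilon(1)=1$, and $\epsilon(gh)=\epsilon(g\,s(\epsilon(h)))=\epsilon(g\,t(\epsilon(h)))$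 for all $g,h\in H$. (2) *Structures $(\Delta,\mu)$ of a bialgebroid with an anchor*: a coassociative bimodule map $\Delta:H\to H\otimes_AH$ with $\mathrm{Im}\,\Delta\subseteq\Gamma$ whose corestriction $H\to\Gamma$ is an algebra map, and an algebra and bimodule map $\mu:H\to\mathrm{End}(A)$ such that, with $h\triangleright a=\mu(h)(a)$, $s(h_{(1)}\triangleright a)h_{(2)}=hs(a)$ and $t(h_{(2)}\triangleright a)h_{(1)}=ht(a)$ for all $a\in A$, $h\in H$. (3) *$\times_A$-bialgebra structures* $(\Delta,\mu)$: maps $\Delta:H\to H\times_AH$ and $\mu:H\to\mathrm{End}(A)$ that are both maps of $A^e$-bimodules and maps of $A^e$-rings (algebra maps respecting source and target), such that $\alpha\circ(\Delta\times_AH)\circ\Delta=\alpha'\circ(H\times_A\Delta)\circ\Delta$ and $\theta\circ(H\times_A\mu)\circ\Delta=\mathrm{id}_H=\theta'\circ(\mu\times_AH)\circ\Delta$. Here $\alpha:(H\times_AH)\times_AH\to H\times_AH\times_AH$ and $\alpha':H\times_A(H\times_AH)\to H\times_AH\times_AH$ are the natural maps into the set $H\times_AH\times_AH$ of all $\sum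 m\otimes p\otimes n\in H\otimes_AH\otimes_AH$ with $\sum mt(a)\otimes p\otimes n=\sum m\otimes ps(a)\otimes n$ and $\sum m\otimes pt(a)\otimes n=\sum m\otimes p\otimes ns(a)$ for all $a\in A$, and $\theta(\sum m\otimes f)=\sum t(f(1))m$, $\theta'(\sum f\otimes m)=\sum s(f(1))m$. (4) *Monoidal structures on the category ${}_H\mathcal M$ of left $H$-modules for which the forgetful functor $F:{}_H\mathcal M\to{}_A\mathcal M_A$ is strict monoidal*, where $F(M)=M$ with $a\cdot m=s(a)m$, $m\cdot a=t(a)m$, and ${}_A\mathcal M_A$ (bimodules over the $k$-algebra $A$, with $k$ acting centrally) has the tensor product $\otimes_A$ and unit object $A$. Strictness means that $F(M\otimes N)=F(M)\otimes_AF(N)$ and $F(\mathbf 1)=A$ are equalities, compatible with tensor products of maps, associators and unitors. The bijections are as follows. Between (1) and (2), $\Delta$ is unchanged, $\mu(h)(a)=\epsilon(hs(a))=\epsilon(ht(a))$ and conversely $\epsilon(h)=\mu(h)(1)$. Between (2) and (3), $\Delta$ (viewed with values in $H\otimes_AH$, respectively in $\Gamma=H\times_AH$) and $\mu$ are unchanged.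 Between (3) and (4), $(\Delta,\mu)$ corresponds to the monoidal structure for which $h\cdot(m\otimes n)=h_{(1)}m\otimes h_{(2)}n$ on $M\otimes_AN$ and $h\cdot a=\mu(h)(a)$ on the unit object $A$. -/

import Mathlib

open CategoryTheory MonoidalCategory TensorProduct

universe v u

/-- An `(A, A)`-bimodule over a `k`-algebra `A` (with `k` acting centrally): a `k`-module with a
left action and a right action of `A` by `k`-linear maps, which commute. The right action is a
left action of the opposite algebra. -/
structure ABimod (k : Type v) [CommRing k] (A : Type u) [Ring A] [Algebra k A] where
  carrier : Type u
  [isAddCommGroup : AddCommGroup carrier]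
  [isModule : Module k carrier]
  left : A →ₐ[k] Module.End k carrier
  right : Aᵐᵒᵖ →ₐ[k] Module.End k carrier
  left_right : ∀ (a : A) (b : Aᵐᵒᵖ) (x : carrier), left a (right b x) = right b (left a x)

namespace ABimod

variable {k : Type v} [CommRing k] {A : Type u} [Ring A] [Algebra k A]

instance : CoeSort (ABimod.{v, u} k A) (Type u) := ⟨ABimod.carrier⟩

instance (X : ABimod.{v, u} k A) : AddCommGroup X := X.isAddCommGroup

instance (X : ABimod.{v, u} k A) : Module k X := X.isModule

/-- Bimodule maps. -/
@[ext]
structure Hom (X Y : ABimod.{v, u} k A) where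
  lin : X →ₗ[k] Y
  map_left : ∀ a x, lin (X.left a x) = Y.left a (lin x)
  map_right : ∀ a x, lin (X.right a x) = Y.right a (lin x)

instance : Category (ABimod.{v, u} k A) where
  Hom X Y := Hom X Y
  id X := ⟨LinearMap.id, fun _ _ => rfl, fun _ _ => rfl⟩
  comp f g := ⟨g.lin ∘ₗ f.lin, fun a x => by simp [f.map_left, g.map_left],
    fun a x => by simp [f.map_right, g.map_right]⟩

instance (X Y : ABimod.{v, u} k A) : CoeFun (X ⟶ Y) (fun _ => X → Y) := ⟨fun f => f.lin⟩

theorem hom_ext {X Y : ABimod.{v, u} k A} {f g : X ⟶ Y} (h : ∀ x, f x = g x) : f = g :=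
  Hom.ext (LinearMap.ext h)

@[simp] theorem id_apply {X : ABimod.{v, u} k A} (x : X) : (𝟙 X : X ⟶ X) x = x := rfl

@[simp] theorem comp_apply {X Y Z : ABimod.{v, u} k A} (f : X ⟶ Y) (g : Y ⟶ Z) (x : X) :
    (f ≫ g) x = g (f x) := rfl

/-! The tensor product `X ⊗_A Y`, the quotient of `X ⊗_k Y` by `x a ⊗ y = x ⊗ a y`. -/

/-- The submodule of `X ⊗_k Y` spanned by the elements `x a ⊗ y - x ⊗ a y`. -/
def rel (X Y : ABimod.{v, u} k A) : Submodule k (X ⊗[k] Y) :=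
  Submodule.span k {z | ∃ (a : A) (x : X) (y : Y),
    z = X.right (MulOpposite.op a) x ⊗ₜ[k] y - x ⊗ₜ[k] Y.left a y}

/-- The underlying module of `X ⊗_A Y`. -/
def Tens (X Y : ABimod.{v, u} k A) : Type u := (X ⊗[k] Y) ⧸ rel X Y

instance (X Y : ABimod.{v, u} k A) : AddCommGroup (Tens X Y) :=
  inferInstanceAs (AddCommGroup ((X ⊗[k] Y) ⧸ rel X Y))

instance (X Y : ABimod.{v, u} k A) : Module k (Tens X Y) :=
  inferInstanceAs (Module k ((X ⊗[k] Y) ⧸ rel X Y))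

/-- The projection `X ⊗_k Y → X ⊗_A Y`. -/
def proj (X Y : ABimod.{v, u} k A) : X ⊗[k] Y →ₗ[k] Tens X Y := (rel X Y).mkQ

theorem proj_surjective (X Y : ABimod.{v, u} k A) : Function.Surjective (proj X Y) :=
  (rel X Y).mkQ_surjective

theorem proj_eq_zero {X Y : ABimod.{v, u} k A} {z : X ⊗[k] Y} (h : z ∈ rel X Y) :
    proj X Y z = 0 := (Submodule.Quotient.mk_eq_zero _).2 h

/-- The element `x ⊗_A y`. -/
def tm {X Y : ABimod.{v, u} k A} (x : X) (y : Y) : Tens X Y := proj X Y (x ⊗ₜ[k] y)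

theorem tm_balanced {X Y : ABimod.{v, u} k A} (a : A) (x : X) (y : Y) :
    tm (X.right (MulOpposite.op a) x) y = tm x (Y.left a y) := by
  rw [← sub_eq_zero]
  unfold tm
  rw [← map_sub]
  exact proj_eq_zero (Submodule.subset_span ⟨a, x, y, rfl⟩)

theorem tm_add {X Y : ABimod.{v, u} k A} (x : X) (y y' : Y) :
    tm x (y + y') = tm x y + tm x y' := by
  simp [tm, TensorProduct.tmul_add]

theorem add_tm {X Y : ABimod.{v, u} k A} (x x' : X) (y : Y) :
    tm (x + x') y = tm x y + tm x' y := by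
  simp [tm, TensorProduct.add_tmul]

theorem tm_smul {X Y : ABimod.{v, u} k A} (c : k) (x : X) (y : Y) :
    tm x (c • y) = c • tm x y := by
  simp [tm]

theorem smul_tm {X Y : ABimod.{v, u} k A} (c : k) (x : X) (y : Y) :
    tm (c • x) y = c • tm x y := by
  unfold tm
  rw [← TensorProduct.smul_tmul', map_smul]

@[elab_as_elim]
theorem tens_induction {X Y : ABimod.{v, u} k A} {p : Tens X Y → Prop} (z : Tens X Y)
    (h0 : p 0) (ht : ∀ x y, p (tm x y)) (hadd : ∀ z w, p z → p w → p (z + w)) : p z := by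
  obtain ⟨w, rfl⟩ := proj_surjective X Y z
  induction w using TensorProduct.induction_on with
  | zero => simpa using h0
  | tmul x y => exact ht x y
  | add z w hz hw => rw [map_add]; exact hadd _ _ hz hw

/-- A balanced bilinear map induces a linear map on `X ⊗_A Y`. -/
def lift {X Y : ABimod.{v, u} k A} {Z : Type u} [AddCommGroup Z] [Module k Z]
    (b : X →ₗ[k] Y →ₗ[k] Z)
    (hb : ∀ a x y, b (X.right (MulOpposite.op a) x) y = b x (Y.left a y)) :
    Tens X Y →ₗ[k] Z :=
  (rel X Y).liftQ (TensorProduct.lift b) (by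
    refine Submodule.span_le.2 ?_
    rintro _ ⟨a, x, y, rfl⟩
    simp [hb])

@[simp] theorem lift_tm {X Y : ABimod.{v, u} k A} {Z : Type u} [AddCommGroup Z] [Module k Z]
    (b : X →ₗ[k] Y →ₗ[k] Z)
    (hb : ∀ a x y, b (X.right (MulOpposite.op a) x) y = b x (Y.left a y)) (x : X) (y : Y) :
    lift b hb (tm x y) = b x y := rfl

/-- `f ⊗_A g` for `k`-linear maps `f`, `g` that respect the inner actions of `A`. -/
def mapLin {X Y X' Y' : ABimod.{v, u} k A} (f : X →ₗ[k] X') (g : Y →ₗ[k] Y')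
    (hf : ∀ a x, f (X.right a x) = X'.right a (f x))
    (hg : ∀ a y, g (Y.left a y) = Y'.left a (g y)) : Tens X Y →ₗ[k] Tens X' Y' :=
  lift ((TensorProduct.mk k X' Y').compl₁₂ f g |>.compr₂ (proj X' Y')) (by
    intro a x y
    simp only [LinearMap.compr₂_apply, LinearMap.compl₁₂_apply, TensorProduct.mk_apply, hf, hg]
    exact tm_balanced a (f x) (g y))

@[simp] theorem mapLin_tm {X Y X' Y' : ABimod.{v, u} k A} (f : X →ₗ[k] X') (g : Y →ₗ[k] Y')
    (hf : ∀ a x, f (X.right a x) = X'.right a (f x))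
    (hg : ∀ a y, g (Y.left a y) = Y'.left a (g y)) (x : X) (y : Y) :
    mapLin f g hf hg (tm x y) = tm (f x) (g y) := rfl

theorem lin_ext {X Y : ABimod.{v, u} k A} {Z : Type u} [AddCommGroup Z] [Module k Z]
    {f g : Tens X Y →ₗ[k] Z} (h : ∀ x y, f (tm x y) = g (tm x y)) : f = g := by
  ext z
  induction z using tens_induction with
  | h0 => simp
  | ht x y => exact h x y
  | hadd z w hz hw => rw [map_add, map_add, hz, hw]

/-- The bimodule `X ⊗_A Y`, with `a (x ⊗ y) b = a x ⊗ y b`. -/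
@[reducible] def tensor (X Y : ABimod.{v, u} k A) : ABimod.{v, u} k A where
  carrier := Tens X Y
  left := AlgHom.ofLinearMap
    { toFun := fun a => mapLin (X.left a) LinearMap.id (fun b x => X.left_right a b x)
        (fun _ _ => rfl)
      map_add' := fun a b => lin_ext fun x y => by simp [add_tm]
      map_smul' := fun c a => lin_ext fun x y => by simp [smul_tm] }
    (lin_ext fun x y => by simp) (fun a b => lin_ext fun x y => by simp)
  right := AlgHom.ofLinearMap
    { toFun := fun a => mapLin LinearMap.id (Y.right a) (fun _ _ => rfl)
        (fun b y => (Y.left_right b a y).symm)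
      map_add' := fun a b => lin_ext fun x y => by simp [tm_add]
      map_smul' := fun c a => lin_ext fun x y => by simp [tm_smul] }
    (lin_ext fun x y => by simp) (fun a b => lin_ext fun x y => by simp)
  left_right a b z := by
    induction z using tens_induction with
    | h0 => simp
    | ht x y => rfl
    | hadd z w hz hw => simp only [map_add, hz, hw]

@[simp] theorem tensor_left_tm {X Y : ABimod.{v, u} k A} (a : A) (x : X) (y : Y) :
    (tensor X Y).left a (tm x y) = tm (X.left a x) y := rfl

@[simp] theorem tensor_right_tm {X Y : ABimod.{v, u} k A} (a : Aᵐᵒᵖ) (x : X) (y : Y) :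
    (tensor X Y).right a (tm x y) = tm x (Y.right a y) := rfl

/-- Construct a bimodule map out of `X ⊗_A Y` from a balanced bilinear map. -/
def homLift {X Y Z : ABimod.{v, u} k A} (b : X →ₗ[k] Y →ₗ[k] Z)
    (hb : ∀ a x y, b (X.right (MulOpposite.op a) x) y = b x (Y.left a y))
    (hl : ∀ a x y, b (X.left a x) y = Z.left a (b x y))
    (hr : ∀ a x y, b x (Y.right a y) = Z.right a (b x y)) : tensor X Y ⟶ Z where
  lin := lift b hb
  map_left a z := LinearMap.congr_fun (lin_ext (f := lift b hb ∘ₗ (tensor X Y).left a)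
    (g := Z.left a ∘ₗ lift b hb) fun x y => hl a x y) z
  map_right a z := LinearMap.congr_fun (lin_ext (f := lift b hb ∘ₗ (tensor X Y).right a)
    (g := Z.right a ∘ₗ lift b hb) fun x y => hr a x y) z

/-- `f ⊗_A g` for bimodule maps. -/
def tensorMap {X Y X' Y' : ABimod.{v, u} k A} (f : X ⟶ X') (g : Y ⟶ Y') :
    tensor X Y ⟶ tensor X' Y' :=
  homLift ((TensorProduct.mk k X' Y').compl₁₂ f.lin g.lin |>.compr₂ (proj X' Y'))
    (fun a x y => (congrArg (fun q => tm q (g y)) (f.map_right _ x)).trans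
      ((tm_balanced a (f x) (g y)).trans (congrArg (tm (f x)) (g.map_left a y).symm)))
    (fun a x y => congrArg (fun q => tm q (g y)) (f.map_left a x))
    (fun a x y => congrArg (tm (f x)) (g.map_right a y))

@[simp] theorem tensorMap_tm {X Y X' Y' : ABimod.{v, u} k A} (f : X ⟶ X') (g : Y ⟶ Y')
    (x : X) (y : Y) : (tensorMap f g) (tm x y) = tm (f x) (g y) := rfl

theorem tensor_hom_ext {X Y Z : ABimod.{v, u} k A} {f g : tensor X Y ⟶ Z}
    (h : ∀ x y, f (tm x y) = g (tm x y)) : f = g := Hom.ext (lin_ext h)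

/-- `tm` as a bilinear map. -/
def tmBilin (X Y : ABimod.{v, u} k A) : X →ₗ[k] Y →ₗ[k] Tens X Y :=
  (TensorProduct.mk k X Y).compr₂ (proj X Y)

@[simp] theorem tmBilin_apply {X Y : ABimod.{v, u} k A} (x : X) (y : Y) :
    tmBilin X Y x y = tm x y := rfl

theorem tensor_hom_ext_left {X Y Z W : ABimod.{v, u} k A} {f g : tensor (tensor X Y) Z ⟶ W}
    (h : ∀ x y z, f (tm (Y := Z) (X := tensor X Y) (tm x y) z) = g (tm (tm x y) z)) : f = g := by
  refine tensor_hom_ext fun w z => ?_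
  have : f.lin ∘ₗ (tmBilin (tensor X Y) Z).flip z = g.lin ∘ₗ (tmBilin (tensor X Y) Z).flip z :=
    lin_ext fun x y => h x y z
  exact LinearMap.congr_fun this w

theorem tensor_hom_ext_right {X Y Z W : ABimod.{v, u} k A} {f g : tensor X (tensor Y Z) ⟶ W}
    (h : ∀ x y z, f (tm (X := X) (Y := tensor Y Z) x (tm y z)) = g (tm x (tm y z))) : f = g := by
  refine tensor_hom_ext fun x w => ?_
  have : f.lin ∘ₗ (tmBilin X (tensor Y Z)) x = g.lin ∘ₗ (tmBilin X (tensor Y Z)) x :=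
    lin_ext fun y z => h x y z
  exact LinearMap.congr_fun this w

/-- The associativity map `(x ⊗ y) ⊗ z ↦ x ⊗ (y ⊗ z)`. -/
def assocHom (X Y Z : ABimod.{v, u} k A) : tensor (tensor X Y) Z ⟶ tensor X (tensor Y Z) :=
  homLift
    (lift (LinearMap.mk₂ k (fun x y => (tmBilin X (tensor Y Z) x) ∘ₗ (tmBilin Y Z y))
        (fun x x' y => LinearMap.ext fun z => add_tm (Y := tensor Y Z) x x' (tm y z))
        (fun c x y => LinearMap.ext fun z => smul_tm (Y := tensor Y Z) c x (tm y z))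
        (fun x y y' => LinearMap.ext fun z =>
          (congrArg (tm (Y := tensor Y Z) x) (add_tm y y' z)).trans
            (tm_add (Y := tensor Y Z) x (tm y z) (tm y' z)))
        (fun c x y => LinearMap.ext fun z =>
          (congrArg (tm (Y := tensor Y Z) x) (smul_tm c y z)).trans
            (tm_smul (Y := tensor Y Z) c x (tm y z))))
      (fun a x y => by
        ext z
        exact tm_balanced (X := X) (Y := tensor Y Z) a x (tm y z)))
    (fun a w z => by
      induction w using tens_induction with
      | h0 => simp
      | ht x y => exact congrArg (tm (X := X) (Y := tensor Y Z) x) (tm_balanced a y z)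
      | hadd w w' hw hw' => simp only [map_add, LinearMap.add_apply, hw, hw'])
    (fun a w z => by
      induction w using tens_induction with
      | h0 => simp
      | ht x y => rfl
      | hadd w w' hw hw' => simp only [map_add, LinearMap.add_apply, hw, hw'])
    (fun a w z => by
      induction w using tens_induction with
      | h0 => simp
      | ht x y => rfl
      | hadd w w' hw hw' => simp only [map_add, LinearMap.add_apply, hw, hw'])

@[simp] theorem assocHom_tm {X Y Z : ABimod.{v, u} k A} (x : X) (y : Y) (z : Z) :
    (assocHom X Y Z) (tm (X := tensor X Y) (Y := Z) (tm x y) z) =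
      tm (X := X) (Y := tensor Y Z) x (tm y z) := rfl

/-- The inverse associativity map `x ⊗ (y ⊗ z) ↦ (x ⊗ y) ⊗ z`. -/
def assocInv (X Y Z : ABimod.{v, u} k A) : tensor X (tensor Y Z) ⟶ tensor (tensor X Y) Z :=
  homLift
    (LinearMap.flip (lift (LinearMap.mk₂ k
        (fun y z => (tmBilin (tensor X Y) Z).flip z ∘ₗ (tmBilin X Y).flip y)
        (fun y y' z => LinearMap.ext fun x =>
          (congrArg (fun q => tm (X := tensor X Y) q z) (tm_add x y y')).trans
            (add_tm (X := tensor X Y) (tm x y) (tm x y') z))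
        (fun c y z => LinearMap.ext fun x =>
          (congrArg (fun q => tm (X := tensor X Y) q z) (tm_smul c x y)).trans
            (smul_tm (X := tensor X Y) c (tm x y) z))
        (fun y z z' => LinearMap.ext fun x => tm_add (X := tensor X Y) (tm x y) z z')
        (fun c y z => LinearMap.ext fun x => tm_smul (X := tensor X Y) c (tm x y) z))
      (fun a y z => by
        ext x
        exact tm_balanced (X := tensor X Y) (Y := Z) a (tm x y) z)))
    (fun a x w => by
      induction w using tens_induction with
      | h0 => simp
      | ht y z => exact congrArg (fun q => tm (X := tensor X Y) (Y := Z) q z) (tm_balanced a x y)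
      | hadd w w' hw hw' => simp only [map_add, hw, hw'])
    (fun a x w => by
      induction w using tens_induction with
      | h0 => simp
      | ht y z => rfl
      | hadd w w' hw hw' => simp only [map_add, hw, hw'])
    (fun a x w => by
      induction w using tens_induction with
      | h0 => simp
      | ht y z => rfl
      | hadd w w' hw hw' => simp only [map_add, hw, hw'])

@[simp] theorem assocInv_tm {X Y Z : ABimod.{v, u} k A} (x : X) (y : Y) (z : Z) :
    (assocInv X Y Z) (tm (X := X) (Y := tensor Y Z) x (tm y z)) =
      tm (X := tensor X Y) (Y := Z) (tm x y) z := rfl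

/-- The algebra `A` as a bimodule over itself. -/
@[reducible] def unit (k : Type v) [CommRing k] (A : Type u) [Ring A] [Algebra k A] : ABimod.{v, u} k A where
  carrier := A
  left := Algebra.lsmul k k A
  right := Algebra.lsmul k k A
  left_right a b x := by simp [mul_assoc]

@[simp] theorem unit_left (a x : A) : (unit k A).left a x = (show A from a * x) := rfl

@[simp] theorem unit_right (a : Aᵐᵒᵖ) (x : A) : (unit k A).right a x = (show A from x * a.unop) := rfl

/-- The map `A ⊗_A X → X`, `a ⊗ x ↦ a x`. -/
def lunitHom (X : ABimod.{v, u} k A) : tensor (unit k A) X ⟶ X :=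
  homLift (X := unit k A) X.left.toLinearMap
    (fun a b x => LinearMap.congr_fun (map_mul X.left (show A from b) a) x)
    (fun a b x => LinearMap.congr_fun (map_mul X.left a (show A from b)) x)
    (fun a b x => X.left_right b a x)

@[simp] theorem lunitHom_tm {X : ABimod.{v, u} k A} (a : A) (x : X) :
    (lunitHom X) (tm (X := unit k A) a x) = X.left a x := rfl

/-- The map `X → A ⊗_A X`, `x ↦ 1 ⊗ x`. -/
def lunitInv (X : ABimod.{v, u} k A) : X ⟶ tensor (unit k A) X where
  lin := tmBilin (unit k A) X (1 : A)
  map_left a x := by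
    have h := tm_balanced (X := unit k A) (Y := X) a (1 : A) x
    have e : (1 : A) * a = a * 1 := by simp
    exact (h.symm.trans (congrArg (fun q => tm (X := unit k A) q x) e))
  map_right a x := rfl

@[simp] theorem lunitInv_apply {X : ABimod.{v, u} k A} (x : X) :
    (lunitInv X) x = tm (X := unit k A) (1 : A) x := rfl

/-- The map `X ⊗_A A → X`, `x ⊗ a ↦ x a`. -/
def runitHom (X : ABimod.{v, u} k A) : tensor X (unit k A) ⟶ X :=
  homLift (Y := unit k A)
    ((X.right.toLinearMap ∘ₗ (MulOpposite.opLinearEquiv k (M := A)).toLinearMap).flip)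
    (fun a x b => (LinearMap.congr_fun
      (map_mul X.right (MulOpposite.op (show A from b)) (MulOpposite.op a)) x).symm)
    (fun a x b => (X.left_right a (MulOpposite.op b) x).symm)
    (fun a x b => LinearMap.congr_fun (map_mul X.right a (MulOpposite.op (show A from b))) x)

@[simp] theorem runitHom_tm {X : ABimod.{v, u} k A} (a : A) (x : X) :
    (runitHom X) (tm (Y := unit k A) x a) = X.right (MulOpposite.op a) x := rfl

/-- The map `X → X ⊗_A A`, `x ↦ x ⊗ 1`. -/
def runitInv (X : ABimod.{v, u} k A) : X ⟶ tensor X (unit k A) where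
  lin := (tmBilin X (unit k A)).flip (1 : A)
  map_left a x := rfl
  map_right a x := by
    have h := tm_balanced (X := X) (Y := unit k A) a.unop x (1 : A)
    have e : a.unop * (1 : A) = 1 * a.unop := by simp
    exact h.trans (congrArg (fun q => tm (Y := unit k A) x q) e)

@[simp] theorem runitInv_apply {X : ABimod.{v, u} k A} (x : X) :
    (runitInv X) x = tm (Y := unit k A) x (1 : A) := rfl

/-- The category of bimodules with the tensor product over `A`, with unit object `A`. -/
instance : MonoidalCategory (ABimod.{v, u} k A) where
  tensorObj X Y := tensor X Y
  tensorHom f g := tensorMap f g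
  whiskerLeft X _ _ f := tensorMap (𝟙 X) f
  whiskerRight f Y := tensorMap f (𝟙 Y)
  tensorUnit := unit k A
  associator X Y Z :=
    { hom := assocHom X Y Z
      inv := assocInv X Y Z
      hom_inv_id := tensor_hom_ext_left fun x y z => rfl
      inv_hom_id := tensor_hom_ext_right fun x y z => rfl }
  leftUnitor X :=
    { hom := lunitHom X
      inv := lunitInv X
      hom_inv_id := tensor_hom_ext fun a x => by
        have h := tm_balanced (X := unit k A) (Y := X) a (1 : A) x
        exact h.symm.trans (congrArg (fun q => tm (X := unit k A) q x) (one_mul (M := A) a))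
      inv_hom_id := hom_ext fun x => LinearMap.congr_fun (map_one X.left) x }
  rightUnitor X :=
    { hom := runitHom X
      inv := runitInv X
      hom_inv_id := tensor_hom_ext fun x a => by
        have h := tm_balanced (X := X) (Y := unit k A) a x (1 : A)
        exact h.trans (congrArg (fun q => tm (Y := unit k A) x q) (mul_one (M := A) a))
      inv_hom_id := hom_ext fun x => LinearMap.congr_fun (map_one X.right) x }
  tensorHom_def f g := tensor_hom_ext fun x y => rfl
  id_tensorHom_id X Y := tensor_hom_ext fun x y => rfl
  tensorHom_comp_tensorHom f g h i := tensor_hom_ext fun x y => rfl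
  whiskerLeft_id X Y := tensor_hom_ext fun x y => rfl
  id_whiskerRight X Y := tensor_hom_ext fun x y => rfl
  associator_naturality f g h := tensor_hom_ext_left fun x y z => rfl
  leftUnitor_naturality f := tensor_hom_ext fun a x => (f.map_left a x).symm
  rightUnitor_naturality f := tensor_hom_ext fun x a =>
    (f.map_right (MulOpposite.op a) x).symm
  pentagon W X Y Z := by
    refine tensor_hom_ext fun p z => ?_
    have key : ∀ (f g : tensor (tensor (tensor W X) Y) Z ⟶ tensor W (tensor X (tensor Y Z))),
        (∀ w x y, f (tm (X := tensor (tensor W X) Y) (tm (X := tensor W X) (tm w x) y) z) =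
          g (tm (X := tensor (tensor W X) Y) (tm (X := tensor W X) (tm w x) y) z)) →
        f (tm (X := tensor (tensor W X) Y) p z) = g (tm (X := tensor (tensor W X) Y) p z) := by
      intro f g h
      have : f.lin ∘ₗ (tmBilin (tensor (tensor W X) Y) Z).flip z =
          g.lin ∘ₗ (tmBilin (tensor (tensor W X) Y) Z).flip z := by
        refine lin_ext fun q y => ?_
        have h2 : f.lin ∘ₗ (tmBilin (tensor (tensor W X) Y) Z).flip z ∘ₗ
              (tmBilin (tensor W X) Y).flip y =
            g.lin ∘ₗ (tmBilin (tensor (tensor W X) Y) Z).flip z ∘ₗ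
              (tmBilin (tensor W X) Y).flip y := lin_ext fun w x => h w x y
        exact LinearMap.congr_fun h2 q
      exact LinearMap.congr_fun this p
    exact key _ _ fun w x y => rfl
  triangle X Y := tensor_hom_ext_left fun x a y => (tm_balanced a x y).symm

end ABimod

/-- An `A^e`-ring `(H, s, t)`: a `k`-algebra `H` with an algebra map `s : A → H` (the source map)
and an anti-algebra map `t : A → H` (the target map), whose images commute. -/
structure AeRing (k : Type v) [CommRing k] (A : Type u) [Ring A] [Algebra k A]
    (H : Type u) [Ring H] [Algebra k H] where
  s : A →ₐ[k] H
  t : Aᵐᵒᵖ →ₐ[k] H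
  comm : ∀ (a : A) (b : Aᵐᵒᵖ), s a * t b = t b * s a

/-- An `A^e`-bimodule, where `A^e = A ⊗ Ā` and `Ā` is the opposite algebra. The left action of
`A^e` is recorded as an `(A, A)`-bimodule: `a · m` is `left a m` and `ā · m` is `right a m`.
The right actions are `m · a = rightA a m` and `m · ā = rightBar a m`. -/
structure AeBimod (k : Type v) [CommRing k] (A : Type u) [Ring A] [Algebra k A] where
  bimod : ABimod.{v, u} k A
  rightA : Aᵐᵒᵖ →ₐ[k] Module.End k bimod
  rightBar : A →ₐ[k] Module.End k bimod
  rightA_rightBar : ∀ b c x, rightA b (rightBar c x) = rightBar c (rightA b x)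
  left_rightA : ∀ a b x, bimod.left a (rightA b x) = rightA b (bimod.left a x)
  right_rightA : ∀ a b x, bimod.right a (rightA b x) = rightA b (bimod.right a x)
  left_rightBar : ∀ a b x, bimod.left a (rightBar b x) = rightBar b (bimod.left a x)
  right_rightBar : ∀ a b x, bimod.right a (rightBar b x) = rightBar b (bimod.right a x)

namespace AeBimod

variable {k : Type v} [CommRing k] {A : Type u} [Ring A] [Algebra k A]

instance : CoeSort (AeBimod.{v, u} k A) (Type u) := ⟨fun M => M.bimod⟩

/-- Maps of `A^e`-bimodules. -/
@[ext]
structure Hom (M N : AeBimod.{v, u} k A) where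
  hom : M.bimod ⟶ N.bimod
  map_rightA : ∀ b x, hom (M.rightA b x) = N.rightA b (hom x)
  map_rightBar : ∀ b x, hom (M.rightBar b x) = N.rightBar b (hom x)

instance (M N : AeBimod.{v, u} k A) : CoeFun (Hom M N) (fun _ => M → N) := ⟨fun f => f.hom⟩

/-- The identity map. -/
def Hom.id (M : AeBimod.{v, u} k A) : Hom M M := ⟨𝟙 M.bimod, fun _ _ => rfl, fun _ _ => rfl⟩

/-- The map `m ↦ m · b`, which is a map of left `A^e`-modules. -/
def rightAHom (M : AeBimod.{v, u} k A) (b : A) : M.bimod ⟶ M.bimod where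
  lin := M.rightA (MulOpposite.op b)
  map_left a x := (M.left_rightA a _ x).symm
  map_right a x := (M.right_rightA a _ x).symm

/-- The map `m ↦ m · b̄`, which is a map of left `A^e`-modules. -/
def rightBarHom (M : AeBimod.{v, u} k A) (b : A) : M.bimod ⟶ M.bimod where
  lin := M.rightBar b
  map_left a x := (M.left_rightBar a _ x).symm
  map_right a x := (M.right_rightBar a _ x).symm

/-- The underlying module of `M ×_A N`: the elements `∑ m ⊗ n` of `M ⊗_A N` (the quotient of
`M ⊗ N` by the relations `ā m ⊗ n = m ⊗ a n`) with `∑ m b̄ ⊗ n = ∑ m ⊗ n b` for all `b`. -/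
def timesSub (M N : AeBimod.{v, u} k A) :
    Submodule k (M.bimod ⊗ N.bimod : ABimod.{v, u} k A) where
  carrier := {x | ∀ b : A, (M.rightBarHom b ▷ N.bimod) x = (M.bimod ◁ N.rightAHom b) x}
  zero_mem' b := by rw [map_zero, map_zero]
  add_mem' hx hy b := by rw [map_add, map_add, hx b, hy b]
  smul_mem' c x hx b := by rw [map_smul, map_smul, hx b]

theorem mem_timesSub {M N : AeBimod.{v, u} k A} {x : (M.bimod ⊗ N.bimod : ABimod.{v, u} k A)} :
    x ∈ timesSub M N ↔
      ∀ b : A, (M.rightBarHom b ▷ N.bimod) x = (M.bimod ◁ N.rightAHom b) x := Iff.rfl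

/-- Restriction of an action to an invariant submodule. -/
def restrictRep {B X : Type u} [Ring B] [Algebra k B] [AddCommGroup X] [Module k X]
    (φ : B →ₐ[k] Module.End k X) (S : Submodule k X) (h : ∀ b, ∀ x ∈ S, φ b x ∈ S) :
    B →ₐ[k] Module.End k S :=
  AlgHom.ofLinearMap
    { toFun := fun b => (φ b).restrict (h b)
      map_add' := fun b c => by ext x; simp
      map_smul' := fun b c => by ext x; simp }
    (by ext x; simp) (fun b c => by ext x; simp)

/-- The right action `(m ⊗ n) · b = m b ⊗ n` on `M ⊗_A N`. -/
def tensRightA (M N : AeBimod.{v, u} k A) :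
    Aᵐᵒᵖ →ₐ[k] Module.End k (M.bimod ⊗ N.bimod : ABimod.{v, u} k A) :=
  AlgHom.ofLinearMap
    { toFun := fun b => (M.rightAHom b.unop ▷ N.bimod).lin
      map_add' := fun a b => ABimod.lin_ext fun x y =>
        (congrArg (fun q => ABimod.tm q y)
          (LinearMap.congr_fun (map_add M.rightA a b) x)).trans (ABimod.add_tm _ _ _)
      map_smul' := fun c a => ABimod.lin_ext fun x y =>
        (congrArg (fun q => ABimod.tm q y)
          (LinearMap.congr_fun (map_smul M.rightA c a) x)).trans (ABimod.smul_tm _ _ _) }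
    (ABimod.lin_ext fun x y => congrArg (fun q => ABimod.tm q y)
      (LinearMap.congr_fun (map_one M.rightA) x))
    (fun a b => ABimod.lin_ext fun x y => congrArg (fun q => ABimod.tm q y)
      (LinearMap.congr_fun (map_mul M.rightA a b) x))

/-- The right action `(m ⊗ n) · b̄ = m ⊗ n b̄` on `M ⊗_A N`. -/
def tensRightBar (M N : AeBimod.{v, u} k A) :
    A →ₐ[k] Module.End k (M.bimod ⊗ N.bimod : ABimod.{v, u} k A) :=
  AlgHom.ofLinearMap
    { toFun := fun b => (M.bimod ◁ N.rightBarHom b).lin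
      map_add' := fun a b => ABimod.lin_ext fun x y =>
        (congrArg (ABimod.tm x)
          (LinearMap.congr_fun (map_add N.rightBar a b) y)).trans (ABimod.tm_add _ _ _)
      map_smul' := fun c a => ABimod.lin_ext fun x y =>
        (congrArg (ABimod.tm x)
          (LinearMap.congr_fun (map_smul N.rightBar c a) y)).trans (ABimod.tm_smul _ _ _) }
    (ABimod.lin_ext fun x y => congrArg (ABimod.tm x)
      (LinearMap.congr_fun (map_one N.rightBar) y))
    (fun a b => ABimod.lin_ext fun x y => congrArg (ABimod.tm x)
      (LinearMap.congr_fun (map_mul N.rightBar a b) y))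

theorem hom_comm {X Y : ABimod.{v, u} k A} {f g : X ⟶ Y} (h : f = g) (x : X) : f x = g x := by
  rw [h]

/-- The `A^e`-bimodule `M ×_A N`, with the actions
`(a ⊗ ā') · (∑ m ⊗ n) · (b ⊗ b̄') = ∑ a m b ⊗ ā' n b̄'`. -/
def times (M N : AeBimod.{v, u} k A) : AeBimod.{v, u} k A where
  bimod :=
    { carrier := timesSub M N
      left := restrictRep (M.bimod ⊗ N.bimod).left (timesSub M N) (fun a x hx b => by
        rw [ABimod.Hom.map_left, ABimod.Hom.map_left, hx b])
      right := restrictRep (M.bimod ⊗ N.bimod).right (timesSub M N) (fun a x hx b => by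
        rw [ABimod.Hom.map_right, ABimod.Hom.map_right, hx b])
      left_right := fun a b x => Subtype.ext ((M.bimod ⊗ N.bimod).left_right a b x.1) }
  rightA := restrictRep (tensRightA M N) (timesSub M N) (fun a x hx b => by
    have e1 : M.rightAHom a.unop ▷ N.bimod ≫ M.rightBarHom b ▷ N.bimod =
        M.rightBarHom b ▷ N.bimod ≫ M.rightAHom a.unop ▷ N.bimod := by
      rw [← comp_whiskerRight, ← comp_whiskerRight]
      congr 1
      exact ABimod.hom_ext fun y => (M.rightA_rightBar a b y).symm
    exact (hom_comm e1 x).trans ((congrArg (M.rightAHom a.unop ▷ N.bimod).lin (hx b)).trans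
      (hom_comm (whisker_exchange (M.rightAHom a.unop) (N.rightAHom b)).symm x).symm))
  rightBar := restrictRep (tensRightBar M N) (timesSub M N) (fun a x hx b => by
    have e1 : M.bimod ◁ N.rightAHom b ≫ M.bimod ◁ N.rightBarHom a =
        M.bimod ◁ N.rightBarHom a ≫ M.bimod ◁ N.rightAHom b := by
      rw [← MonoidalCategory.whiskerLeft_comp, ← MonoidalCategory.whiskerLeft_comp]
      congr 1
      exact ABimod.hom_ext fun y => (N.rightA_rightBar _ _ y).symm
    exact (hom_comm (whisker_exchange (M.rightBarHom b) (N.rightBarHom a)) x).trans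
      ((congrArg (M.bimod ◁ N.rightBarHom a).lin (hx b)).trans (hom_comm e1 x)))
  rightA_rightBar b c x := Subtype.ext
    (hom_comm (whisker_exchange (M.rightAHom b.unop) (N.rightBarHom c)).symm x.1).symm
  left_rightA a b x := Subtype.ext ((M.rightAHom b.unop ▷ N.bimod).map_left a x.1).symm
  right_rightA a b x := Subtype.ext ((M.rightAHom b.unop ▷ N.bimod).map_right a x.1).symm
  left_rightBar a b x := Subtype.ext ((M.bimod ◁ N.rightBarHom b).map_left a x.1).symm
  right_rightBar a b x := Subtype.ext ((M.bimod ◁ N.rightBarHom b).map_right a x.1).symm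

/-- The inclusion `M ×_A N → M ⊗_A N`. -/
def incl (M N : AeBimod.{v, u} k A) : (times M N).bimod ⟶ M.bimod ⊗ N.bimod where
  lin := (timesSub M N).subtype
  map_left _ _ := rfl
  map_right _ _ := rfl

/-- Functoriality of `×_A`: the restriction of `f ⊗_A g`. -/
def timesMap {M N M' N' : AeBimod.{v, u} k A} (f : Hom M M') (g : Hom N N') :
    Hom (times M N) (times M' N') where
  hom :=
    { lin := (f.hom ⊗ₘ g.hom).lin.restrict (fun x hx b => by
        have e1 : (f.hom ⊗ₘ g.hom) ≫ M'.rightBarHom b ▷ N'.bimod =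
            M.rightBarHom b ▷ N.bimod ≫ (f.hom ⊗ₘ g.hom) :=
          ABimod.tensor_hom_ext fun x y =>
            congrArg (fun q => ABimod.tm q (g y)) (f.map_rightBar b x).symm
        have e2 : (f.hom ⊗ₘ g.hom) ≫ M'.bimod ◁ N'.rightAHom b =
            M.bimod ◁ N.rightAHom b ≫ (f.hom ⊗ₘ g.hom) :=
          ABimod.tensor_hom_ext fun x y =>
            congrArg (ABimod.tm (f x)) (g.map_rightA (MulOpposite.op b) y).symm
        exact (hom_comm e1 x).trans ((congrArg (f.hom ⊗ₘ g.hom).lin (hx b)).trans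
          (hom_comm e2 x).symm))
      map_left := fun a x => Subtype.ext ((f.hom ⊗ₘ g.hom).map_left a x.1)
      map_right := fun a x => Subtype.ext ((f.hom ⊗ₘ g.hom).map_right a x.1) }
  map_rightA b x := Subtype.ext (hom_comm
    (ABimod.tensor_hom_ext (f := M.rightAHom b.unop ▷ N.bimod ≫ (f.hom ⊗ₘ g.hom))
      (g := (f.hom ⊗ₘ g.hom) ≫ M'.rightAHom b.unop ▷ N'.bimod) fun x y =>
        congrArg (fun q => ABimod.tm q (g y)) (f.map_rightA b x)) x.1)
  map_rightBar b x := Subtype.ext (hom_comm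
    (ABimod.tensor_hom_ext (f := M.bimod ◁ N.rightBarHom b ≫ (f.hom ⊗ₘ g.hom))
      (g := (f.hom ⊗ₘ g.hom) ≫ M'.bimod ◁ N'.rightBarHom b) fun x y =>
        congrArg (ABimod.tm (f x)) (g.map_rightBar b y)) x.1)

/-- The triple product `M ×_A P ×_A N`: the elements `∑ m ⊗ p ⊗ n` of `M ⊗_A P ⊗_A N` with
`∑ m s̄ ⊗ p ⊗ n = ∑ m ⊗ p s ⊗ n` and `∑ m ⊗ p ū ⊗ n = ∑ m ⊗ p ⊗ n u` for all `s`, `u`. -/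
def triple (M P N : AeBimod.{v, u} k A) :
    Submodule k ((M.bimod ⊗ P.bimod) ⊗ N.bimod : ABimod.{v, u} k A) where
  carrier := {x |
    (∀ s : A, ((M.rightBarHom s ▷ P.bimod) ▷ N.bimod) x =
      ((M.bimod ◁ P.rightAHom s) ▷ N.bimod) x) ∧
    (∀ u : A, ((M.bimod ◁ P.rightBarHom u) ▷ N.bimod) x =
      ((M.bimod ⊗ P.bimod) ◁ N.rightAHom u) x)}
  zero_mem' := ⟨fun b => by rw [map_zero, map_zero], fun b => by rw [map_zero, map_zero]⟩
  add_mem' hx hy := ⟨fun b => by rw [map_add, map_add, hx.1 b, hy.1 b],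
    fun b => by rw [map_add, map_add, hx.2 b, hy.2 b]⟩
  smul_mem' c x hx := ⟨fun b => by rw [map_smul, map_smul, hx.1 b],
    fun b => by rw [map_smul, map_smul, hx.2 b]⟩

/-- The natural map `α : (M ×_A P) ×_A N → M ×_A P ×_A N`, `(m ⊗ p) ⊗ n ↦ m ⊗ p ⊗ n`. -/
def alpha (M P N : AeBimod.{v, u} k A) : times (times M P) N →ₗ[k] triple M P N :=
  (incl M P ▷ N.bimod).lin.restrict (p := timesSub (times M P) N) (fun x hx => by
    constructor
    · intro s
      have e : incl M P ≫ M.rightBarHom s ▷ P.bimod = incl M P ≫ M.bimod ◁ P.rightAHom s :=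
        ABimod.hom_ext fun y => y.2 s
      have e' := congrArg (fun q => q ▷ N.bimod) e
      simp only [comp_whiskerRight] at e'
      exact hom_comm e' x
    · intro u
      have e : (times M P).rightBarHom u ≫ incl M P = incl M P ≫ M.bimod ◁ P.rightBarHom u :=
        ABimod.hom_ext fun y => rfl
      have e' := congrArg (fun q => q ▷ N.bimod) e
      simp only [comp_whiskerRight] at e'
      exact (hom_comm e' x).symm.trans ((congrArg (incl M P ▷ N.bimod).lin (hx u)).trans
        (hom_comm (whisker_exchange (incl M P) (N.rightAHom u)) x)))

/-- The natural map `α' : M ×_A (P ×_A N) → M ×_A P ×_A N`, `m ⊗ (p ⊗ n) ↦ m ⊗ p ⊗ n`. -/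
def alpha' (M P N : AeBimod.{v, u} k A) : times M (times P N) →ₗ[k] triple M P N :=
  (M.bimod ◁ incl P N ≫ (α_ M.bimod P.bimod N.bimod).inv).lin.restrict
    (p := timesSub M (times P N)) (fun x hx => by
    constructor
    · intro s
      have e1 : (M.bimod ◁ incl P N ≫ (α_ M.bimod P.bimod N.bimod).inv) ≫
            (M.rightBarHom s ▷ P.bimod) ▷ N.bimod =
          M.rightBarHom s ▷ (times P N).bimod ≫
            (M.bimod ◁ incl P N ≫ (α_ M.bimod P.bimod N.bimod).inv) := by
        rw [← whisker_exchange_assoc, Category.assoc]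
        simp
      have e2 : (M.bimod ◁ incl P N ≫ (α_ M.bimod P.bimod N.bimod).inv) ≫
            (M.bimod ◁ P.rightAHom s) ▷ N.bimod =
          M.bimod ◁ (times P N).rightAHom s ≫
            (M.bimod ◁ incl P N ≫ (α_ M.bimod P.bimod N.bimod).inv) := by
        have e : (times P N).rightAHom s ≫ incl P N = incl P N ≫ P.rightAHom s ▷ N.bimod :=
          ABimod.hom_ext fun y => rfl
        have e' := congrArg (fun q => M.bimod ◁ q) e
        simp only [MonoidalCategory.whiskerLeft_comp] at e'
        rw [reassoc_of% e']
        simp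
      exact (hom_comm e1 x).trans ((congrArg
        (M.bimod ◁ incl P N ≫ (α_ M.bimod P.bimod N.bimod).inv).lin (hx s)).trans
          (hom_comm e2 x).symm)
    · intro u
      have e : incl P N ≫ P.rightBarHom u ▷ N.bimod = incl P N ≫ P.bimod ◁ N.rightAHom u :=
        ABimod.hom_ext fun y => y.2 u
      have e' := congrArg (fun q => M.bimod ◁ q ≫ (α_ M.bimod P.bimod N.bimod).inv) e
      have e1 : (M.bimod ◁ incl P N ≫ (α_ M.bimod P.bimod N.bimod).inv) ≫
            (M.bimod ◁ P.rightBarHom u) ▷ N.bimod =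
          (M.bimod ◁ incl P N ≫ (α_ M.bimod P.bimod N.bimod).inv) ≫
            (M.bimod ⊗ P.bimod : ABimod.{v, u} k A) ◁ N.rightAHom u := by
        simpa using e'
      exact hom_comm e1 x)

end AeBimod

namespace AeRing

variable {k : Type v} [CommRing k] {A : Type u} [Ring A] [Algebra k A]
variable {H : Type u} [Ring H] [Algebra k H]

/-- `H` as an `(A, A)`-bimodule: `a · h = s(a) h`, `h · a = t(a) h`. -/
@[reducible] def bimod (R : AeRing.{v, u} k A H) : ABimod.{v, u} k A where
  carrier := H
  left := (Algebra.lsmul k k H).comp R.s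
  right := (Algebra.lsmul k k H).comp R.t
  left_right a b x := by
    change R.s a * (R.t b * x) = R.t b * (R.s a * x)
    rw [← mul_assoc, ← mul_assoc, R.comm]

/-- `H` as an `A^e`-bimodule: `a · h · b = s(a) h s(b)`, `ā · h · b̄ = t(a) h t(b)`. -/
@[reducible] def aeBimod (R : AeRing.{v, u} k A H) : AeBimod.{v, u} k A where
  bimod := R.bimod
  rightA := (Algebra.lsmul k k H : Hᵐᵒᵖ →ₐ[k] Module.End k H).comp (AlgHom.op R.s)
  rightBar := (Algebra.lsmul k k H : Hᵐᵒᵖ →ₐ[k] Module.End k H).comp (AlgHom.opComm.symm R.t)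
  rightA_rightBar b c x := by
    change (x * R.t (MulOpposite.op c)) * R.s b.unop = (x * R.s b.unop) * R.t (MulOpposite.op c)
    rw [mul_assoc, mul_assoc, R.comm]
  left_rightA a b x := (mul_assoc (R.s a) x (R.s b.unop)).symm
  right_rightA a b x := (mul_assoc (R.t a) x (R.s b.unop)).symm
  left_rightBar a b x := (mul_assoc (R.s a) x (R.t (MulOpposite.op b))).symm
  right_rightBar a b x := (mul_assoc (R.t a) x (R.t (MulOpposite.op b))).symm

/-- The algebra of `k`-linear endomorphisms of `A` as an `A^e`-ring, with `s(a)(x) = a x` and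
`t(b)(x) = x b`. -/
def endRing (k : Type v) [CommRing k] (A : Type u) [Ring A] [Algebra k A] :
    AeRing.{v, u} k A (Module.End k A) where
  s := Algebra.lsmul k k A
  t := Algebra.lsmul k k A
  comm a b := LinearMap.ext fun x => (mul_assoc a x b.unop).symm

/-- Evaluation `f ↦ f(a)`, a map of `(A, A)`-bimodules from the endomorphism ring to `A`. -/
def evalAt (a : A) : (endRing k A).bimod ⟶ 𝟙_ (ABimod.{v, u} k A) where
  lin := LinearMap.applyₗ (R := k) a
  map_left _ _ := rfl
  map_right _ _ := rfl

section product

variable {U V : Type u} [Ring U] [Algebra k U] [Ring V] [Algebra k V]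
variable (R : AeRing.{v, u} k A U) (S : AeRing.{v, u} k A V)

/-- The element `c ⊗_A d` of `U ⊗_A V`. -/
def pure (c : U) (d : V) : (R.bimod ⊗ S.bimod : ABimod.{v, u} k A) :=
  ABimod.proj R.bimod S.bimod (c ⊗ₜ[k] d)

theorem pure_balanced (a : A) (c : U) (d : V) :
    pure R S (R.t (MulOpposite.op a) * c) d = pure R S c (S.s a * d) :=
  ABimod.tm_balanced (X := R.bimod) (Y := S.bimod) a c d

theorem rel_mul {w p : U ⊗[k] V} (hw : w ∈ ABimod.rel R.bimod S.bimod) :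
    w * p ∈ ABimod.rel R.bimod S.bimod := by
  induction hw using Submodule.span_induction with
  | mem w h =>
    obtain ⟨a, x, y, rfl⟩ := h
    induction p using TensorProduct.induction_on with
    | zero => rw [mul_zero]; exact zero_mem _
    | tmul c d =>
      refine Submodule.subset_span ⟨a, x * c, y * d, ?_⟩
      change (((R.t (MulOpposite.op a) * x) ⊗ₜ[k] y - x ⊗ₜ[k] (S.s a * y) : U ⊗[k] V)) *
          (c ⊗ₜ[k] d) =
        (R.t (MulOpposite.op a) * (x * c)) ⊗ₜ[k] (y * d) - (x * c) ⊗ₜ[k] (S.s a * (y * d))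
      rw [sub_mul, Algebra.TensorProduct.tmul_mul_tmul, Algebra.TensorProduct.tmul_mul_tmul,
        mul_assoc, mul_assoc]
    | add p q hp hq => rw [mul_add]; exact add_mem hp hq
  | zero => rw [zero_mul]; exact zero_mem _
  | add w z _ _ hw hz => rw [add_mul]; exact add_mem hw hz
  | smul c w _ hw => rw [smul_mul_assoc]; exact Submodule.smul_mem _ c hw

/-- The right action of `U ⊗_k V` on `U ⊗_A V`: `(u ⊗_A v) (c ⊗ d) = u c ⊗_A v d`. -/
def actR : (R.bimod ⊗ S.bimod : ABimod.{v, u} k A) →ₗ[k]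
    U ⊗[k] V →ₗ[k] (R.bimod ⊗ S.bimod : ABimod.{v, u} k A) :=
  (ABimod.rel R.bimod S.bimod).liftQ
    ((LinearMap.mul k (U ⊗[k] V)).compr₂ (ABimod.proj R.bimod S.bimod)) (by
      intro w hw
      refine LinearMap.mem_ker.2 (LinearMap.ext fun p => ?_)
      exact ABimod.proj_eq_zero (rel_mul R S hw))

theorem actR_proj (w p : U ⊗[k] V) :
    actR R S (ABimod.proj R.bimod S.bimod w) p = ABimod.proj R.bimod S.bimod (w * p) := rfl

theorem actR_actR (x : (R.bimod ⊗ S.bimod : ABimod.{v, u} k A)) (p q : U ⊗[k] V) :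
    actR R S (actR R S x p) q = actR R S x (p * q) := by
  obtain ⟨w, rfl⟩ := ABimod.proj_surjective _ _ x
  rw [actR_proj, actR_proj, actR_proj, mul_assoc]

theorem mem_iff (x : (R.bimod ⊗ S.bimod : ABimod.{v, u} k A)) :
    x ∈ AeBimod.timesSub R.aeBimod S.aeBimod ↔ ∀ b : A,
      actR R S x (R.t (MulOpposite.op b) ⊗ₜ[k] 1) = actR R S x (1 ⊗ₜ[k] S.s b) := by
  have e1 : ∀ b : A, (R.aeBimod.rightBarHom b ▷ S.bimod) x =
      actR R S x (R.t (MulOpposite.op b) ⊗ₜ[k] 1) := fun b =>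
    LinearMap.congr_fun (ABimod.lin_ext (f := (R.aeBimod.rightBarHom b ▷ S.bimod).lin)
      (g := (actR R S).flip (R.t (MulOpposite.op b) ⊗ₜ[k] 1)) fun u w => by
        change pure R S (u * R.t (MulOpposite.op b)) w = ABimod.proj R.bimod S.bimod
          ((u ⊗ₜ[k] w : U ⊗[k] V) * (R.t (MulOpposite.op b) ⊗ₜ[k] 1))
        rw [Algebra.TensorProduct.tmul_mul_tmul, mul_one]; rfl) x
  have e2 : ∀ b : A, (R.bimod ◁ S.aeBimod.rightAHom b) x = actR R S x (1 ⊗ₜ[k] S.s b) := fun b =>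
    LinearMap.congr_fun (ABimod.lin_ext (f := (R.bimod ◁ S.aeBimod.rightAHom b).lin)
      (g := (actR R S).flip (1 ⊗ₜ[k] S.s b)) fun u w => by
        change pure R S u (w * S.s b) = ABimod.proj R.bimod S.bimod
          ((u ⊗ₜ[k] w : U ⊗[k] V) * (1 ⊗ₜ[k] S.s b))
        rw [Algebra.TensorProduct.tmul_mul_tmul, mul_one]; rfl) x
  constructor
  · intro h b
    rw [← e1, ← e2]
    exact h b
  · intro h b
    exact (e1 b).trans ((h b).trans (e2 b).symm)

/-- Left multiplication by `x ∈ U ×_A V` on `U ⊗_A V`: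
`(∑ x¹ ⊗ x²) (c ⊗ d) = ∑ x¹ c ⊗ x² d`. -/
def lmulT (x : AeBimod.timesSub R.aeBimod S.aeBimod) :
    (R.bimod ⊗ S.bimod : ABimod.{v, u} k A) →ₗ[k] (R.bimod ⊗ S.bimod : ABimod.{v, u} k A) :=
  (ABimod.rel R.bimod S.bimod).liftQ (actR R S x.1) (by
    refine Submodule.span_le.2 ?_
    rintro _ ⟨a, c, d, rfl⟩
    have h := (mem_iff R S x.1).1 x.2 a
    have h' := congrArg (fun q => actR R S q (c ⊗ₜ[k] d)) h
    simp only [actR_actR, Algebra.TensorProduct.tmul_mul_tmul, one_mul] at h'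
    refine LinearMap.mem_ker.2 ?_
    rw [map_sub, sub_eq_zero]
    exact h')

theorem lmulT_proj (x : AeBimod.timesSub R.aeBimod S.aeBimod) (p : U ⊗[k] V) :
    lmulT R S x (ABimod.proj R.bimod S.bimod p) = actR R S x.1 p := rfl

theorem lmulT_actR (x : AeBimod.timesSub R.aeBimod S.aeBimod)
    (y : (R.bimod ⊗ S.bimod : ABimod.{v, u} k A)) (p : U ⊗[k] V) :
    lmulT R S x (actR R S y p) = actR R S (lmulT R S x y) p := by
  obtain ⟨w, rfl⟩ := ABimod.proj_surjective _ _ y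
  rw [actR_proj, lmulT_proj, lmulT_proj, actR_actR]

theorem pure_mem (c : U) (d : V)
    (h : ∀ b : A, pure R S (c * R.t (MulOpposite.op b)) d = pure R S c (d * S.s b)) :
    pure R S c d ∈ AeBimod.timesSub R.aeBimod S.aeBimod := h

instance : One (AeBimod.timesSub R.aeBimod S.aeBimod) :=
  ⟨⟨pure R S 1 1, pure_mem R S 1 1 fun b => by
    have h := pure_balanced R S b 1 1
    rw [mul_one, mul_one] at h
    rw [one_mul, one_mul]
    exact h⟩⟩

/-- The product `(∑ g¹ ⊗ g²) (∑ h¹ ⊗ h²) = ∑ g¹ h¹ ⊗ g² h²` on `U ×_A V`. -/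
instance : Mul (AeBimod.timesSub R.aeBimod S.aeBimod) :=
  ⟨fun x y => ⟨lmulT R S x y.1, (mem_iff R S _).2 fun b => by
    rw [← lmulT_actR, ← lmulT_actR, (mem_iff R S y.1).1 y.2 b]⟩⟩

theorem coe_mul (x y : AeBimod.timesSub R.aeBimod S.aeBimod) :
    (x * y).1 = lmulT R S x y.1 := rfl

theorem coe_one : (1 : AeBimod.timesSub R.aeBimod S.aeBimod).1 =
    ABimod.proj R.bimod S.bimod 1 := rfl

instance : Ring (AeBimod.timesSub R.aeBimod S.aeBimod) :=
  { (inferInstance : AddCommGroup (AeBimod.timesSub R.aeBimod S.aeBimod)) with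
    mul := (· * ·)
    one := 1
    left_distrib := fun x y z => Subtype.ext (map_add (lmulT R S x) y.1 z.1)
    right_distrib := fun x y z => Subtype.ext (by
      obtain ⟨p, hp⟩ := ABimod.proj_surjective _ _ z.1
      change lmulT R S (x + y) z.1 = lmulT R S x z.1 + lmulT R S y z.1
      rw [← hp, lmulT_proj, lmulT_proj, lmulT_proj]
      exact LinearMap.congr_fun (map_add (actR R S) x.1 y.1) p)
    zero_mul := fun x => Subtype.ext (by
      obtain ⟨p, hp⟩ := ABimod.proj_surjective _ _ x.1
      change lmulT R S 0 x.1 = 0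
      rw [← hp, lmulT_proj]
      exact LinearMap.congr_fun (map_zero (actR R S)) p)
    mul_zero := fun x => Subtype.ext (map_zero (lmulT R S x))
    mul_assoc := fun x y z => Subtype.ext (by
      obtain ⟨p, hp⟩ := ABimod.proj_surjective _ _ z.1
      change lmulT R S (x * y) z.1 = lmulT R S x (lmulT R S y z.1)
      rw [← hp, lmulT_proj, lmulT_proj, lmulT_actR, coe_mul])
    one_mul := fun x => Subtype.ext (by
      obtain ⟨p, hp⟩ := ABimod.proj_surjective _ _ x.1
      change lmulT R S 1 x.1 = x.1
      rw [← hp, lmulT_proj, coe_one, actR_proj, one_mul])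
    mul_one := fun x => Subtype.ext (by
      obtain ⟨p, hp⟩ := ABimod.proj_surjective _ _ x.1
      change lmulT R S x (ABimod.proj R.bimod S.bimod 1) = x.1
      rw [lmulT_proj, ← hp, actR_proj, mul_one]) }

instance : Algebra k (AeBimod.timesSub R.aeBimod S.aeBimod) :=
  Algebra.ofModule
    (fun c x y => Subtype.ext (by
      obtain ⟨p, hp⟩ := ABimod.proj_surjective _ _ y.1
      change lmulT R S (c • x) y.1 = c • lmulT R S x y.1
      rw [← hp, lmulT_proj, lmulT_proj]
      exact LinearMap.congr_fun (map_smul (actR R S) c x.1) p))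
    (fun c x y => Subtype.ext (map_smul (lmulT R S x) c y.1))

/-- The product of elements represented by pure tensors. -/
theorem pure_mul_pure (x y : AeBimod.timesSub R.aeBimod S.aeBimod) (c c' : U) (d d' : V)
    (hx : x.1 = pure R S c d)
    (hy : y.1 = pure R S c' d') :
    (x * y).1 = pure R S (c * c') (d * d') := by
  rw [coe_mul, hy]
  change actR R S x.1 (c' ⊗ₜ[k] d') = _
  rw [hx]
  change ABimod.proj R.bimod S.bimod ((c ⊗ₜ[k] d) * (c' ⊗ₜ[k] d')) = _
  rw [Algebra.TensorProduct.tmul_mul_tmul]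
  rfl

/-- The element `s(a) ⊗ t(b)` of `U ×_A V`. -/
def st (a : A) (b : Aᵐᵒᵖ) : AeBimod.timesSub R.aeBimod S.aeBimod :=
  ⟨pure R S (R.s a) (S.t b), pure_mem R S _ _ fun c => by
    rw [R.comm, ← S.comm]
    exact pure_balanced R S c (R.s a) (S.t b)⟩

/-- `U ×_A V` as an `A^e`-ring, with source `a ↦ s(a) ⊗ 1` and target `b ↦ 1 ⊗ t(b)`. -/
def prod : AeRing.{v, u} k A (AeBimod.timesSub R.aeBimod S.aeBimod) where
  s := AlgHom.ofLinearMap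
    { toFun := fun a => st R S a 1
      map_add' := fun a b => Subtype.ext (by
        change pure R S (R.s (a + b)) (S.t 1) = _
        rw [map_add]; exact ABimod.add_tm (X := R.bimod) (Y := S.bimod) _ _ _)
      map_smul' := fun c a => Subtype.ext (by
        change pure R S (R.s (c • a)) (S.t 1) = _
        rw [map_smul]; exact ABimod.smul_tm (X := R.bimod) (Y := S.bimod) _ _ _) }
    (Subtype.ext (by
      change pure R S (R.s 1) (S.t 1) = _
      rw [map_one, map_one]; rfl))
    (fun a b => Subtype.ext (by
      change pure R S (R.s (a * b)) (S.t 1) = _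
      refine Eq.symm ((pure_mul_pure R S _ _ _ _ _ _ rfl rfl).trans ?_)
      rw [map_mul, map_one, mul_one]))
  t := AlgHom.ofLinearMap
    { toFun := fun b => st R S 1 b
      map_add' := fun a b => Subtype.ext (by
        change pure R S (R.s 1) (S.t (a + b)) = _
        rw [map_add]; exact ABimod.tm_add (X := R.bimod) (Y := S.bimod) _ _ _)
      map_smul' := fun c a => Subtype.ext (by
        change pure R S (R.s 1) (S.t (c • a)) = _
        rw [map_smul]; exact ABimod.tm_smul (X := R.bimod) (Y := S.bimod) _ _ _) }
    (Subtype.ext (by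
      change pure R S (R.s 1) (S.t 1) = _
      rw [map_one, map_one]; rfl))
    (fun a b => Subtype.ext (by
      change pure R S (R.s 1) (S.t (a * b)) = _
      refine Eq.symm ((pure_mul_pure R S _ _ _ _ _ _ rfl rfl).trans ?_)
      rw [map_mul, map_one, mul_one]))
  comm a b := Subtype.ext ((pure_mul_pure R S _ _ _ _ _ _ rfl rfl).trans
    (Eq.symm ((pure_mul_pure R S _ _ _ _ _ _ rfl rfl).trans (by simp))))

end product

end AeRing

namespace AeBimod

variable {k : Type v} [CommRing k] {A : Type u} [Ring A] [Algebra k A]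

/-- The map `θ : M ×_A End(A) → M`, `∑ m ⊗ f ↦ ∑ \overline{f(1)} m`. -/
def theta (M : AeBimod.{v, u} k A) : times M (AeRing.endRing k A).aeBimod → M :=
  incl M (AeRing.endRing k A).aeBimod ≫ M.bimod ◁ AeRing.evalAt 1 ≫ (ρ_ M.bimod).hom

/-- The map `θ' : End(A) ×_A M → M`, `∑ f ⊗ m ↦ ∑ f(1) m`. -/
def theta' (M : AeBimod.{v, u} k A) : times (AeRing.endRing k A).aeBimod M → M :=
  incl (AeRing.endRing k A).aeBimod M ≫ AeRing.evalAt 1 ▷ M.bimod ≫ (λ_ M.bimod).hom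

end AeBimod

/-! The four kinds of structures. -/

/-- `(X, Δ, ε)` is an `A`-coring, for bimodule maps `Δ : X → X ⊗_A X` and `ε : X → A`. -/
structure IsACoring {k : Type v} [CommRing k] {A : Type u} [Ring A] [Algebra k A]
    (X : ABimod.{v, u} k A) (comul : X ⟶ X ⊗ X) (counit : X ⟶ 𝟙_ (ABimod.{v, u} k A)) : Prop where
  coassoc : comul ≫ comul ▷ X ≫ (α_ X X X).hom = comul ≫ X ◁ comul
  counit_left : comul ≫ counit ▷ X ≫ (λ_ X).hom = 𝟙 X
  counit_right : comul ≫ X ◁ counit ≫ (ρ_ X).hom = 𝟙 X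

/-- A `×_A`-coalgebra: an `A^e`-bimodule `L` with `A^e`-bimodule maps `Δ : L → L ×_A L` and
`μ : L → End(A)` such that `α (Δ ×_A L) Δ = α' (L ×_A Δ) Δ` and
`θ (L ×_A μ) Δ = L = θ' (μ ×_A L) Δ`. -/
structure IsTimesCoalgebra {k : Type v} [CommRing k] {A : Type u} [Ring A] [Algebra k A]
    (L : AeBimod.{v, u} k A) (comul : AeBimod.Hom L (AeBimod.times L L))
    (anchor : AeBimod.Hom L (AeRing.endRing k A).aeBimod) : Prop where
  coassoc : ∀ x : L,
    AeBimod.alpha L L L (AeBimod.timesMap comul (AeBimod.Hom.id L) (comul x)) =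
      AeBimod.alpha' L L L (AeBimod.timesMap (AeBimod.Hom.id L) comul (comul x))
  counit_right : ∀ x : L,
    AeBimod.theta L (AeBimod.timesMap (AeBimod.Hom.id L) anchor (comul x)) = x
  counit_left : ∀ x : L,
    AeBimod.theta' L (AeBimod.timesMap anchor (AeBimod.Hom.id L) (comul x)) = x

/-- A functor between monoidal categories is strict monoidal if it preserves tensor products and
the unit object on the nose, and preserves tensor products of maps, associators and unitors. -/
structure IsStrictMonoidal {C : Type*} [Category C] [MonoidalCategory C]
    {D : Type*} [Category D] [MonoidalCategory D] (F : C ⥤ D) : Prop where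
  obj_tensor : ∀ X Y : C, F.obj (X ⊗ Y) = F.obj X ⊗ F.obj Y
  obj_unit : F.obj (𝟙_ C) = 𝟙_ D
  map_tensor : ∀ {X X' Y Y' : C} (f : X ⟶ X') (g : Y ⟶ Y'),
    F.map (f ⊗ₘ g) =
      eqToHom (obj_tensor X Y) ≫ (F.map f ⊗ₘ F.map g) ≫ eqToHom (obj_tensor X' Y').symm
  map_associator : ∀ X Y Z : C,
    F.map (α_ X Y Z).hom =
      eqToHom (obj_tensor (X ⊗ Y) Z) ≫ eqToHom (obj_tensor X Y) ▷ F.obj Z ≫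
        (α_ (F.obj X) (F.obj Y) (F.obj Z)).hom ≫
          F.obj X ◁ eqToHom (obj_tensor Y Z).symm ≫ eqToHom (obj_tensor X (Y ⊗ Z)).symm
  map_leftUnitor : ∀ X : C,
    F.map (λ_ X).hom =
      eqToHom (obj_tensor (𝟙_ C) X) ≫ eqToHom obj_unit ▷ F.obj X ≫ (λ_ (F.obj X)).hom
  map_rightUnitor : ∀ X : C,
    F.map (ρ_ X).hom =
      eqToHom (obj_tensor X (𝟙_ C)) ≫ F.obj X ◁ eqToHom obj_unit ≫ (ρ_ (F.obj X)).hom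

namespace AeRing

variable {k : Type v} [CommRing k] {A : Type u} [Ring A] [Algebra k A]
variable {H : Type u} [Ring H] [Algebra k H]

/-- The `A^e`-ring `Γ(H, s, t) = H ×_A H`, as a submodule of `H ⊗_A H`: the elements
`∑ g¹ ⊗ g²` with `∑ g¹ t(a) ⊗ g² = ∑ g¹ ⊗ g² s(a)` for all `a`. -/
abbrev gamma (R : AeRing.{v, u} k A H) : Submodule k (R.bimod ⊗ R.bimod : ABimod.{v, u} k A) :=
  AeBimod.timesSub R.aeBimod R.aeBimod

/-- `f` is a map of `A^e`-rings: a `k`-algebra map that respects source and target maps. -/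
def IsAeRingMap {U V : Type u} [Ring U] [Algebra k U] [Ring V] [Algebra k V]
    (R : AeRing.{v, u} k A U) (S : AeRing.{v, u} k A V) (f : U → V) : Prop :=
  ∃ g : U →ₐ[k] V, (∀ x, g x = f x) ∧ (∀ a, g (R.s a) = S.s a) ∧ (∀ b, g (R.t b) = S.t b)

/-- A bialgebroid structure `(Δ, ε)` on `(H, s, t)`. -/
structure LuBialgebroid (R : AeRing.{v, u} k A H) where
  comul : R.bimod ⟶ R.bimod ⊗ R.bimod
  counit : R.bimod ⟶ 𝟙_ (ABimod.{v, u} k A)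
  coring : IsACoring R.bimod comul counit
  /-- `Δ` takes values in `Γ`, and its corestriction `H → Γ` is an algebra map. -/
  comul_alg : ∃ f : H →ₐ[k] R.gamma, ∀ h : H, (f h).1 = comul h
  counit_one : counit (1 : H) = (1 : A)
  counit_mul_s : ∀ g h : H, counit (g * h : H) = counit (g * R.s (counit h) : H)
  counit_mul_t : ∀ g h : H,
    counit (g * h : H) = counit (g * R.t (MulOpposite.op (counit h)) : H)

/-- The counit, as a function from `H` to `A`. -/
def LuBialgebroid.eps {R : AeRing.{v, u} k A H} (B : LuBialgebroid R) (h : H) : A := B.counit h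

/-- A structure `(Δ, μ)` of a bialgebroid with an anchor on `(H, s, t)`. -/
structure AnchoredBialgebroid (R : AeRing.{v, u} k A H) where
  comul : R.bimod ⟶ R.bimod ⊗ R.bimod
  coassoc : comul ≫ comul ▷ R.bimod ≫ (α_ R.bimod R.bimod R.bimod).hom = comul ≫ R.bimod ◁ comul
  /-- `Δ` takes values in `Γ`, and its corestriction `H → Γ` is an algebra map. -/
  comul_alg : ∃ f : H →ₐ[k] R.gamma, ∀ h : H, (f h).1 = comul h
  anchor : R.bimod ⟶ (endRing k A).bimod
  anchor_alg : ∃ f : H →ₐ[k] Module.End k A, ∀ h : H, f h = anchor h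
  /-- `s(h₍₁₎ ▷ a) h₍₂₎ = h s(a)`, where `h ▷ a = μ(h)(a)`. -/
  anchor_s : ∀ (a : A) (h : H),
    ((anchor ≫ evalAt a) ▷ R.bimod ≫ (λ_ R.bimod).hom) (comul h) = h * R.s a
  /-- `t(h₍₂₎ ▷ a) h₍₁₎ = h t(a)`, where `h ▷ a = μ(h)(a)`. -/
  anchor_t : ∀ (a : A) (h : H),
    (R.bimod ◁ (anchor ≫ evalAt a) ≫ (ρ_ R.bimod).hom) (comul h) = h * R.t (MulOpposite.op a)

/-- The anchor, as a function from `H` to the endomorphisms of `A`. -/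
def AnchoredBialgebroid.mu {R : AeRing.{v, u} k A H} (B : AnchoredBialgebroid R) (h : H) :
    Module.End k A := B.anchor h

/-- A structure `(Δ, μ)` of a `×_A`-bialgebra on `(H, s, t)`. -/
structure TakeuchiBialgebra (R : AeRing.{v, u} k A H) where
  comul : AeBimod.Hom R.aeBimod (AeBimod.times R.aeBimod R.aeBimod)
  anchor : AeBimod.Hom R.aeBimod (endRing k A).aeBimod
  coalgebra : IsTimesCoalgebra R.aeBimod comul anchor
  comul_ringMap : IsAeRingMap R (prod R R) comul
  anchor_ringMap : IsAeRingMap R (endRing k A) anchor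

/-- The map `μ`, as a function from `H` to the endomorphisms of `A`. -/
def TakeuchiBialgebra.mu {R : AeRing.{v, u} k A H} (B : TakeuchiBialgebra R) (h : H) :
    Module.End k A := B.anchor h

theorem smul_smul_restrict (M : ModuleCat.{u} H) (c : k) (h : H) (m : M) :
    (c • h) • m = algebraMap k H c • (h • m) := by
  rw [Algebra.smul_def, mul_smul]

/-- A left `H`-module as an `(A, A)`-bimodule: `a · m = s(a) m`, `m · a = t(a) m`. -/
def restrict (R : AeRing.{v, u} k A H) (M : ModuleCat.{u} H) : ABimod.{v, u} k A :=
  letI : Module k M := Module.compHom M (algebraMap k H)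
  haveI : IsScalarTower k H M := ⟨smul_smul_restrict M⟩
  { carrier := M
    left := (Algebra.lsmul k k M).comp R.s
    right := (Algebra.lsmul k k M).comp R.t
    left_right := fun a b x => by
      change R.s a • (R.t b • x) = R.t b • (R.s a • x)
      rw [← mul_smul, ← mul_smul, R.comm] }

/-- The forgetful functor (restriction of scalars) from left `H`-modules to bimodules. -/
def forget (R : AeRing.{v, u} k A H) : ModuleCat.{u} H ⥤ ABimod.{v, u} k A where
  obj M := R.restrict M
  map {M N} f :=
    { lin :=
        { toFun := f.hom
          map_add' := fun x y => f.hom.map_add x y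
          map_smul' := fun c x => f.hom.map_smul (algebraMap k H c) x }
      map_left := fun a x => f.hom.map_smul (R.s a) x
      map_right := fun a x => f.hom.map_smul (R.t a) x }

/-- A monoidal structure on the category of left `H`-modules for which the forgetful functor to
`(A, A)`-bimodules is strict monoidal. -/
structure StrictMonoidalLift (R : AeRing.{v, u} k A H) where
  monoidal : MonoidalCategory (ModuleCat.{u} H)
  strict : IsStrictMonoidal R.forget

/-- The action of `h` on the left `H`-module `M`. -/
def act (R : AeRing.{v, u} k A H) (M : ModuleCat.{u} H) (h : H) (m : R.forget.obj M) :
    R.forget.obj M := HSMul.hSMul (α := H) (β := M) h m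

/-- The map of bimodules `H → M`, `h ↦ h m`. -/
def orbit (R : AeRing.{v, u} k A H) (M : ModuleCat.{u} H) (m : R.forget.obj M) :
    R.bimod ⟶ R.forget.obj M where
  lin :=
    { toFun := fun h => R.act M h m
      map_add' := fun g h => add_smul (R := H) (M := M) g h m
      map_smul' := fun c h => smul_smul_restrict M c h m }
  map_left a h := mul_smul (β := M) (R.s a) h m
  map_right a h := mul_smul (β := M) (R.t a) h m

/-- The monoidal structure is given by `(Δ, μ)`: the action of `H` on `M ⊗_A N` is
`h (m ⊗ n) = h₍₁₎ m ⊗ h₍₂₎ n`, and its action on the unit object `A` is `h ▷ a = μ(h)(a)`. -/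
def IsInducedBy (R : AeRing.{v, u} k A H) [MonoidalCategory (ModuleCat.{u} H)]
    (hF : IsStrictMonoidal R.forget) (B : TakeuchiBialgebra R) : Prop :=
  (∀ (M N : ModuleCat.{u} H) (m : R.forget.obj M) (n : R.forget.obj N) (h : H),
    (eqToHom (hF.obj_tensor M N)) (R.act (M ⊗ N) h
        ((eqToHom (hF.obj_tensor M N).symm) (ABimod.tm m n))) =
      (R.orbit M m ⊗ₘ R.orbit N n) (B.comul h).1) ∧
  (∀ (a : A) (h : H),
    (eqToHom hF.obj_unit) (R.act (𝟙_ (ModuleCat.{u} H)) h ((eqToHom hF.obj_unit.symm) a)) =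
      B.mu h a)

end AeRing

/-! Structure (2), the bialgebroid with an anchor, is the hub: it is compared with each of the other
three. From (1) to (2): the identity `ε(gh) = ε(g s(ε(h)))` says that `h ▷ a = ε(h s(a))` is an
action of `H` on `A`, and `ε(h) = h ▷ 1` recovers the counit. Since `Δ` is multiplicative with
`Δ(s(a)) = s(a) ⊗ 1` and `Δ(t(a)) = 1 ⊗ t(a)`, the two anchor equations are the counit laws
evaluated at `h s(a)` and `h t(a)` (`comul_mul_s`, `comul_mul_t`); at `a = 1` they give the counit
laws back. From (2) to (3): the same formulas make `Δ` and `μ` linear for the right actions of `A^e`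
and compatible with source and target, so the extra requirements of (3) are automatic. The maps `α`,
`α'` are restrictions of an inclusion and an inverse associator, so coassociativity may be tested in
`H ⊗_A H ⊗_A H`. From (2) to (4): `H ×_A H` acts on `M ⊗_A N` (`gammaRep`), and `H` acts through
`Δ`; it acts on `A` through `μ`. Coassociativity makes the associator of bimodules `H`-linear, and
the anchor equations do this for the unitors. The coherence axioms then hold because the forgetful
functor is faithful. From (4) to (2): put `Δ(h) = h (1 ⊗ 1)` in `H ⊗_A H` and let `μ` be the action
on `A`. Naturality along the `H`-linear maps `H → M`, `h ↦ h m`, shows that this `Δ` governs every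
tensor product (`StrictMonoidalLift.isTensorAction`). The relation `t(b) ⊗ 1 = 1 ⊗ s(b)` puts `Δ(h)`
in `H ×_A H`, and `H`-linearity of the associator and the unitors at units gives the remaining
axioms. The passages are mutually inverse because `Δ` and `μ` can be read off from the actions
(`Induces.eq`), and the actions determine the monoidal structure (`Induces.lift_eq`). Throughout,
`H`-linearity of `φ` is the equation `orbit m ≫ φ = orbit (φ m)` between bimodule maps out of `H`,
so most arguments are diagram computations among bimodules. The predicates `IsTensorAction` and
`IsUnitAction` are relative to an arbitrary isomorphism; equalities of objects enter only through
`eqToIso`. -/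

namespace ABimod

variable {k : Type v} [CommRing k] {A : Type u} [Ring A] [Algebra k A]

theorem tensorHom_tm {X Y X' Y' : ABimod.{v, u} k A} (f : X ⟶ X') (g : Y ⟶ Y') (x : X) (y : Y) :
    (f ⊗ₘ g) (tm x y) = tm (f x) (g y) := rfl

end ABimod

/-! ### The structure maps of a `×_A`-coalgebra, computed in the ambient tensor products -/

namespace AeBimod

variable {k : Type v} [CommRing k] {A : Type u} [Ring A] [Algebra k A]

/-- Being a restriction, `×_A` on maps is invisible after inclusion, so the counit condition of a
`×_A`-coalgebra becomes the usual counit law for `f` followed by evaluation at `1`. -/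
theorem theta_timesMap_id {M N : AeBimod.{v, u} k A} (f : Hom N (AeRing.endRing k A).aeBimod)
    (x : times M N) :
    theta M (timesMap (Hom.id M) f x) =
      (M.bimod ◁ (f.hom ≫ AeRing.evalAt 1) ≫ (ρ_ M.bimod).hom) x.1 := by
  have e : (𝟙 M.bimod ⊗ₘ f.hom) ≫ M.bimod ◁ AeRing.evalAt 1 ≫ (ρ_ M.bimod).hom =
      M.bimod ◁ (f.hom ≫ AeRing.evalAt 1) ≫ (ρ_ M.bimod).hom := by simp
  exact hom_comm e x.1

theorem theta'_timesMap_id {M N : AeBimod.{v, u} k A} (f : Hom M (AeRing.endRing k A).aeBimod)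
    (x : times M N) :
    theta' N (timesMap f (Hom.id N) x) =
      ((f.hom ≫ AeRing.evalAt 1) ▷ N.bimod ≫ (λ_ N.bimod).hom) x.1 := by
  have e : (f.hom ⊗ₘ 𝟙 N.bimod) ≫ AeRing.evalAt 1 ▷ N.bimod ≫ (λ_ N.bimod).hom =
      (f.hom ≫ AeRing.evalAt 1) ▷ N.bimod ≫ (λ_ N.bimod).hom := by simp
  exact hom_comm e x.1

/-- Together with its mirror image for `alpha'`, this turns `×_A`-coassociativity into
coassociativity of the map with values in `⊗_A`. -/
theorem coe_alpha_timesMap_id {L M P N : AeBimod.{v, u} k A} (f : Hom L (times M P))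
    (x : times L N) :
    (alpha M P N (timesMap f (Hom.id N) x)).1 = ((f.hom ≫ incl M P) ▷ N.bimod) x.1 := by
  have e : (f.hom ⊗ₘ 𝟙 N.bimod) ≫ incl M P ▷ N.bimod = (f.hom ≫ incl M P) ▷ N.bimod := by simp
  exact hom_comm e x.1

theorem coe_alpha'_timesMap_id {L M P N : AeBimod.{v, u} k A} (f : Hom L (times P N))
    (x : times M L) :
    (alpha' M P N (timesMap (Hom.id M) f x)).1 =
      (M.bimod ◁ (f.hom ≫ incl P N) ≫ (α_ M.bimod P.bimod N.bimod).inv) x.1 := by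
  have e : (𝟙 M.bimod ⊗ₘ f.hom) ≫ M.bimod ◁ incl P N ≫ (α_ M.bimod P.bimod N.bimod).inv =
      M.bimod ◁ (f.hom ≫ incl P N) ≫ (α_ M.bimod P.bimod N.bimod).inv := by simp
  exact hom_comm e x.1

end AeBimod

/-! ### Multiplicativity of the comultiplication and right multiplication maps -/

namespace AeRing

variable {k : Type v} [CommRing k] {A : Type u} [Ring A] [Algebra k A]
variable {H : Type u} [Ring H] [Algebra k H]

/-- Right multiplication by `x`, a map of bimodules. -/
def mulRight (R : AeRing.{v, u} k A H) (x : H) : R.bimod ⟶ R.bimod where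
  lin := LinearMap.mulRight k x
  map_left a h := mul_assoc (R.s a) h x
  map_right a h := mul_assoc (R.t a) h x

theorem mulRight_one (R : AeRing.{v, u} k A H) : R.mulRight 1 = 𝟙 R.bimod :=
  ABimod.hom_ext fun h => mul_one (M := H) h

theorem actR_tmul {U V : Type u} [Ring U] [Algebra k U] [Ring V] [Algebra k V]
    (R : AeRing.{v, u} k A U) (S : AeRing.{v, u} k A V)
    (z : (R.bimod ⊗ S.bimod : ABimod.{v, u} k A)) (c : U) (d : V) :
    actR R S z (c ⊗ₜ[k] d) = (R.mulRight c ⊗ₘ S.mulRight d) z :=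
  LinearMap.congr_fun (ABimod.lin_ext (f := (actR R S).flip (c ⊗ₜ[k] d))
    (g := (R.mulRight c ⊗ₘ S.mulRight d).lin) fun u w => by
      change ABimod.proj R.bimod S.bimod ((u ⊗ₜ[k] w : U ⊗[k] V) * (c ⊗ₜ[k] d)) =
        ABimod.proj R.bimod S.bimod ((show U from u * c) ⊗ₜ[k] (show V from w * d))
      rw [Algebra.TensorProduct.tmul_mul_tmul]) z

/-- The source and target of `U ×_A V` have pure tensors as values, so multiplication by them on the
right is a tensor product of bimodule maps and can be moved through diagrams. -/
theorem coe_mul_of_eq_pure {U V : Type u} [Ring U] [Algebra k U] [Ring V] [Algebra k V]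
    {R : AeRing.{v, u} k A U} {S : AeRing.{v, u} k A V}
    (x y : AeBimod.timesSub R.aeBimod S.aeBimod) {c : U} {d : V} (hy : y.1 = pure R S c d) :
    (x * y).1 = (R.mulRight c ⊗ₘ S.mulRight d) x.1 := by
  rw [coe_mul, hy]
  exact actR_tmul R S x.1 c d

section comul

variable {R : AeRing.{v, u} k A H} {comul : R.bimod ⟶ R.bimod ⊗ R.bimod}

theorem comul_one (hc : ∃ f : H →ₐ[k] R.gamma, ∀ h : H, (f h).1 = comul h) :
    comul (1 : H) = pure R R 1 1 := by
  obtain ⟨f, hf⟩ := hc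
  rw [← hf, map_one]
  rfl

/-- Compatibility with the source costs no hypothesis: `s(a) = a · 1`, `Δ` is a bimodule map and
`Δ(1) = 1 ⊗ 1`. -/
theorem comul_s (hc : ∃ f : H →ₐ[k] R.gamma, ∀ h : H, (f h).1 = comul h) (a : A) :
    comul (R.s a) = pure R R (R.s a) 1 := by
  have h : comul (R.s a * 1 : H) = (R.bimod ⊗ R.bimod : ABimod.{v, u} k A).left a (comul (1 : H)) :=
    comul.map_left a (1 : H)
  rw [mul_one, comul_one hc] at h
  refine h.trans ?_
  change ABimod.tm (X := R.bimod) (Y := R.bimod) (R.s a * 1 : H) (1 : H) = _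
  rw [mul_one]
  rfl

theorem comul_t (hc : ∃ f : H →ₐ[k] R.gamma, ∀ h : H, (f h).1 = comul h) (a : Aᵐᵒᵖ) :
    comul (R.t a) = pure R R 1 (R.t a) := by
  have h : comul (R.t a * 1 : H) =
      (R.bimod ⊗ R.bimod : ABimod.{v, u} k A).right a (comul (1 : H)) :=
    comul.map_right a (1 : H)
  rw [mul_one, comul_one hc] at h
  refine h.trans ?_
  change ABimod.tm (X := R.bimod) (Y := R.bimod) (1 : H) (R.t a * 1 : H) = _
  rw [mul_one]
  rfl

/-- Multiplicativity against `Δ(s(a)) = s(a) ⊗ 1` only affects the first leg. This is both the right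
`A`-linearity of `Δ` and the bridge between counit laws and anchor equations. -/
theorem comul_mul_s (hc : ∃ f : H →ₐ[k] R.gamma, ∀ h : H, (f h).1 = comul h) (h : H) (a : A) :
    comul (h * R.s a : H) = (R.mulRight (R.s a) ▷ R.bimod) (comul h) := by
  have hs := comul_s hc a
  obtain ⟨f, hf⟩ := hc
  rw [← hf, ← hf, map_mul, coe_mul_of_eq_pure (f h) (f (R.s a)) ((hf _).trans hs), mulRight_one,
    tensorHom_id]

theorem comul_mul_t (hc : ∃ f : H →ₐ[k] R.gamma, ∀ h : H, (f h).1 = comul h) (h : H) (a : Aᵐᵒᵖ) :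
    comul (h * R.t a : H) = (R.bimod ◁ R.mulRight (R.t a)) (comul h) := by
  have hs := comul_t hc a
  obtain ⟨f, hf⟩ := hc
  rw [← hf, ← hf, map_mul, coe_mul_of_eq_pure (f h) (f (R.t a)) ((hf _).trans hs), mulRight_one,
    id_tensorHom]

end comul

/-! ### Bialgebroids and anchors -/

namespace LuBialgebroid

variable {R : AeRing.{v, u} k A H}

@[ext]
theorem ext' {B C : LuBialgebroid R} (h₁ : B.comul = C.comul) (h₂ : ∀ h, B.eps h = C.eps h) :
    B = C := by
  have h₂' : B.counit = C.counit := ABimod.hom_ext h₂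
  cases B; cases C
  cases h₁; cases h₂'
  rfl

variable (B : LuBialgebroid R)

theorem eps_s_mul (a : A) (h : H) : B.eps (R.s a * h) = a * B.eps h := B.counit.map_left a h

theorem eps_t_mul (a : Aᵐᵒᵖ) (h : H) : B.eps (R.t a * h) = B.eps h * a.unop :=
  B.counit.map_right a h

theorem eps_one : B.eps 1 = 1 := B.counit_one

theorem eps_s (a : A) : B.eps (R.s a) = a := by
  simpa [eps_one] using B.eps_s_mul a 1

theorem eps_t (a : Aᵐᵒᵖ) : B.eps (R.t a) = a.unop := by
  simpa [eps_one] using B.eps_t_mul a 1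

theorem eps_mul (g h : H) : B.eps (g * h) = B.eps (g * R.s (B.eps h)) := B.counit_mul_s g h

/-- Only `ε(t(a)) = a` matters here: `ε(gh)` depends on `h` through `ε(h)` alone. -/
theorem eps_mul_t (h : H) (a : A) : B.eps (h * R.t (MulOpposite.op a)) = B.eps (h * R.s a) := by
  rw [eps_mul, eps_t, MulOpposite.unop_op]

/-- The anchor `h ↦ (a ↦ ε(h s(a)))` of a bialgebroid. -/
def anchorHom : R.bimod ⟶ (endRing k A).bimod where
  lin := LinearMap.mk₂ k (fun h a => B.eps (h * R.s a))
    (fun g h a => by rw [add_mul]; exact map_add B.counit.lin _ _)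
    (fun c h a => by rw [smul_mul_assoc]; exact map_smul B.counit.lin _ _)
    (fun h a b => by rw [map_add, mul_add]; exact map_add B.counit.lin _ _)
    (fun c h a => by rw [map_smul, mul_smul_comm]; exact map_smul B.counit.lin _ _)
  map_left a h := LinearMap.ext fun x =>
    (congrArg B.eps (mul_assoc (R.s a) h (R.s x))).trans (B.eps_s_mul a (h * R.s x))
  map_right a h := LinearMap.ext fun x =>
    (congrArg B.eps (mul_assoc (R.t a) h (R.s x))).trans (B.eps_t_mul a (h * R.s x))

theorem anchorHom_evalAt (a : A) : B.anchorHom ≫ evalAt a = R.mulRight (R.s a) ≫ B.counit := rfl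

theorem anchorHom_evalAt' (a : A) :
    B.anchorHom ≫ evalAt a = R.mulRight (R.t (MulOpposite.op a)) ≫ B.counit :=
  ABimod.hom_ext fun h => (B.eps_mul_t h a).symm

/-- A bialgebroid, as a bialgebroid with an anchor. -/
def toAnchored : AnchoredBialgebroid R where
  comul := B.comul
  coassoc := B.coring.coassoc
  comul_alg := B.comul_alg
  anchor := B.anchorHom
  anchor_alg := by
    refine ⟨AlgHom.ofLinearMap B.anchorHom.lin (LinearMap.ext fun a => ?_)
      fun g h => LinearMap.ext fun a => ?_, fun h => rfl⟩
    · change B.eps (1 * R.s a) = a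
      rw [one_mul, eps_s]
    -- Associativity of the action on `A` is the defining identity of `ε` for the pair `g`, `h
    -- s(a)`.
    · change B.eps (g * h * R.s a) = B.eps (g * R.s (B.eps (h * R.s a)))
      rw [mul_assoc, eps_mul]
  anchor_s a h := by
    -- The left counit law at `h s(a)`: the factor `s(a)` lands in the first leg of `Δ(h)`, where
    -- `ε` turns it into `h₍₁₎ ▷ a`.
    have e := AeBimod.hom_comm B.coring.counit_left (h * R.s a : H)
    refine Eq.trans ?_ e
    rw [anchorHom_evalAt, comp_whiskerRight, ABimod.comp_apply, ABimod.comp_apply,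
      ABimod.comp_apply, ABimod.comp_apply, comul_mul_s B.comul_alg]
  anchor_t a h := by
    have e := AeBimod.hom_comm B.coring.counit_right (h * R.t (MulOpposite.op a) : H)
    refine Eq.trans ?_ e
    rw [anchorHom_evalAt', MonoidalCategory.whiskerLeft_comp, ABimod.comp_apply, ABimod.comp_apply,
      ABimod.comp_apply, ABimod.comp_apply, comul_mul_t B.comul_alg]

end LuBialgebroid

namespace AnchoredBialgebroid

variable {R : AeRing.{v, u} k A H}

@[ext]
theorem ext' {B C : AnchoredBialgebroid R} (h₁ : B.comul = C.comul) (h₂ : ∀ h, B.mu h = C.mu h) :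
    B = C := by
  have h₂' : B.anchor = C.anchor := ABimod.hom_ext h₂
  cases B; cases C
  cases h₁; cases h₂'
  rfl

variable (B : AnchoredBialgebroid R)

theorem mu_one : B.mu 1 = 1 := by
  obtain ⟨f, hf⟩ := B.anchor_alg
  exact (hf 1).symm.trans (map_one f)

theorem mu_mul (g h : H) : B.mu (g * h) = B.mu g * B.mu h := by
  obtain ⟨f, hf⟩ := B.anchor_alg
  exact (hf _).symm.trans ((map_mul f g h).trans (congrArg₂ (· * ·) (hf g) (hf h)))

theorem mu_s (a x : A) : B.mu (R.s a) x = a * x := by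
  have h : B.mu (R.s a * 1) = (endRing k A).s a * B.mu 1 := B.anchor.map_left a (1 : H)
  rw [mul_one, mu_one, mul_one] at h
  rw [h]
  rfl

theorem mu_t (a : Aᵐᵒᵖ) (x : A) : B.mu (R.t a) x = x * a.unop := by
  have h : B.mu (R.t a * 1) = (endRing k A).t a * B.mu 1 := B.anchor.map_right a (1 : H)
  rw [mul_one, mu_one, mul_one] at h
  rw [h]
  rfl

/-- A bialgebroid with an anchor, as a bialgebroid with counit `h ↦ μ(h)(1)`. -/
def toLu : LuBialgebroid R where
  comul := B.comul
  counit := B.anchor ≫ evalAt 1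
  coring :=
    { coassoc := B.coassoc
      counit_left := ABimod.hom_ext fun h => (B.anchor_s 1 h).trans (by
        rw [map_one]; exact mul_one (M := H) h)
      counit_right := ABimod.hom_ext fun h => (B.anchor_t 1 h).trans (by
        rw [MulOpposite.op_one, map_one]; exact mul_one (M := H) h) }
  comul_alg := B.comul_alg
  counit_one := LinearMap.congr_fun B.mu_one 1
  counit_mul_s g h := by
    change B.mu (g * h) 1 = B.mu (g * R.s (B.mu h 1)) 1
    -- Both sides are `g ▷ (h ▷ 1)`, because `s(b) ▷ 1 = b`.
    rw [mu_mul, mu_mul, Module.End.mul_apply, Module.End.mul_apply, mu_s, mul_one]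
  counit_mul_t g h := by
    change B.mu (g * h) 1 = B.mu (g * R.t (MulOpposite.op (B.mu h 1))) 1
    rw [mu_mul, mu_mul, Module.End.mul_apply, Module.End.mul_apply, mu_t, one_mul,
      MulOpposite.unop_op]

end AnchoredBialgebroid

/-- Bialgebroid structures correspond to structures of a bialgebroid with an anchor. -/
def luEquivAnchored (R : AeRing.{v, u} k A H) : R.LuBialgebroid ≃ R.AnchoredBialgebroid where
  toFun := LuBialgebroid.toAnchored
  invFun := AnchoredBialgebroid.toLu
  left_inv B := LuBialgebroid.ext' rfl fun h => by
    change B.eps (h * R.s 1) = B.eps h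
    rw [map_one, mul_one]
  right_inv B := AnchoredBialgebroid.ext' rfl fun h => LinearMap.ext fun a => by
    change B.mu (h * R.s a) 1 = B.mu h a
    rw [B.mu_mul, Module.End.mul_apply, B.mu_s, mul_one]

/-! ### Anchored bialgebroids and `×_A`-bialgebras -/

namespace TakeuchiBialgebra

variable {R : AeRing.{v, u} k A H}

theorem ext' {B C : TakeuchiBialgebra R} (h₁ : ∀ h, (B.comul h).1 = (C.comul h).1)
    (h₂ : ∀ h, B.mu h = C.mu h) : B = C := by
  have h₁' : B.comul = C.comul :=
    AeBimod.Hom.ext (ABimod.hom_ext fun h => Subtype.ext (h₁ h))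
  have h₂' : B.anchor = C.anchor := AeBimod.Hom.ext (ABimod.hom_ext h₂)
  cases B; cases C
  cases h₁'; cases h₂'
  rfl

variable (B : TakeuchiBialgebra R)

/-- The comultiplication of a `×_A`-bialgebra, with values in `H ⊗_A H`. -/
def comulHom : R.bimod ⟶ R.bimod ⊗ R.bimod :=
  B.comul.hom ≫ AeBimod.incl R.aeBimod R.aeBimod

theorem comul_alg : ∃ f : H →ₐ[k] R.gamma, ∀ h : H, (f h).1 = B.comulHom h := by
  obtain ⟨f, hf, -⟩ := B.comul_ringMap
  exact ⟨f, fun h => congrArg Subtype.val (hf h)⟩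

/-- A `×_A`-bialgebra, as a bialgebroid with an anchor. -/
def toAnchored : AnchoredBialgebroid R where
  comul := B.comulHom
  coassoc := by
    have e : B.comulHom ≫ B.comulHom ▷ R.bimod =
        B.comulHom ≫ R.bimod ◁ B.comulHom ≫ (α_ R.bimod R.bimod R.bimod).inv :=
      ABimod.hom_ext fun h => (AeBimod.coe_alpha_timesMap_id B.comul (B.comul h)).symm.trans
        ((congrArg Subtype.val (B.coalgebra.coassoc h)).trans
          (AeBimod.coe_alpha'_timesMap_id B.comul (B.comul h)))
    rw [← Category.assoc, e]
    simp
  comul_alg := B.comul_alg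
  anchor := B.anchor.hom
  anchor_alg := by
    obtain ⟨f, hf, -⟩ := B.anchor_ringMap
    exact ⟨f, hf⟩
  anchor_s a h := by
    -- As for bialgebroids, the anchor equation is the counit law at `h s(a)`.
    have e := B.coalgebra.counit_left (h * R.s a : H)
    rw [AeBimod.theta'_timesMap_id] at e
    -- Right linearity of `μ` moves `s(a)` into the argument: `μ(h s(a))(1) = μ(h)(a · 1)`.
    have e₁ : R.mulRight (R.s a) ≫ B.anchor.hom ≫ evalAt 1 = B.anchor.hom ≫ evalAt a :=
      ABimod.hom_ext fun h => by
        refine (LinearMap.congr_fun (B.anchor.map_rightA (MulOpposite.op a) h) 1).trans ?_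
        change B.mu h (a * 1) = B.mu h a
        rw [mul_one]
    refine Eq.trans ?_ e
    refine Eq.trans ?_ (congrArg ((B.anchor.hom ≫ evalAt 1) ▷ R.bimod ≫ (λ_ R.bimod).hom).lin
      (comul_mul_s B.comul_alg h a).symm)
    rw [← e₁, comp_whiskerRight, Category.assoc]
    rfl
  anchor_t a h := by
    have e := B.coalgebra.counit_right (h * R.t (MulOpposite.op a) : H)
    rw [AeBimod.theta_timesMap_id] at e
    have e₁ : R.mulRight (R.t (MulOpposite.op a)) ≫ B.anchor.hom ≫ evalAt 1 =
        B.anchor.hom ≫ evalAt a :=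
      ABimod.hom_ext fun h => by
        refine (LinearMap.congr_fun (B.anchor.map_rightBar a h) 1).trans ?_
        change B.mu h (1 * a) = B.mu h a
        rw [one_mul]
    refine Eq.trans ?_ e
    refine Eq.trans ?_ (congrArg (R.bimod ◁ (B.anchor.hom ≫ evalAt 1) ≫ (ρ_ R.bimod).hom).lin
      (comul_mul_t B.comul_alg h (MulOpposite.op a)).symm)
    rw [← e₁, MonoidalCategory.whiskerLeft_comp, Category.assoc]
    rfl

end TakeuchiBialgebra

namespace AnchoredBialgebroid
variable {R : AeRing.{v, u} k A H} (B : AnchoredBialgebroid R)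

theorem comul_mem (h : H) : B.comul h ∈ AeBimod.timesSub R.aeBimod R.aeBimod := by
  obtain ⟨f, hf⟩ := B.comul_alg
  rw [← hf]
  exact (f h).2

/-- The comultiplication of a bialgebroid with an anchor, with values in `H ×_A H`. -/
def timesComul : AeBimod.Hom R.aeBimod (AeBimod.times R.aeBimod R.aeBimod) where
  hom :=
    { lin := B.comul.lin.codRestrict _ B.comul_mem
      map_left := fun a h => Subtype.ext (B.comul.map_left a h)
      map_right := fun a h => Subtype.ext (B.comul.map_right a h) }
  map_rightA b h := Subtype.ext (comul_mul_s B.comul_alg h b.unop)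
  map_rightBar b h := Subtype.ext (comul_mul_t B.comul_alg h (MulOpposite.op b))

/-- The anchor, as a map of `A^e`-bimodules. -/
def aeAnchor : AeBimod.Hom R.aeBimod (endRing k A).aeBimod where
  hom := B.anchor
  map_rightA b h := LinearMap.ext fun x => by
    change B.mu (h * R.s b.unop) x = B.mu h (b.unop * x)
    rw [mu_mul, Module.End.mul_apply, mu_s]
  map_rightBar b h := LinearMap.ext fun x => by
    change B.mu (h * R.t (MulOpposite.op b)) x = B.mu h (x * b)
    rw [mu_mul, Module.End.mul_apply, mu_t, MulOpposite.unop_op]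

theorem timesComul_incl :
    B.timesComul.hom ≫ AeBimod.incl R.aeBimod R.aeBimod = B.comul := rfl

theorem comul_whiskerRight : B.comul ≫ B.comul ▷ R.bimod =
    B.comul ≫ R.bimod ◁ B.comul ≫ (α_ R.bimod R.bimod R.bimod).inv := by
  rw [← Category.assoc, Iso.eq_comp_inv, Category.assoc, B.coassoc]

/-- A bialgebroid with an anchor, as a `×_A`-bialgebra. -/
def toTakeuchi : TakeuchiBialgebra R where
  comul := B.timesComul
  anchor := B.aeAnchor
  coalgebra :=
    { coassoc := fun h => Subtype.ext <| by
        rw [AeBimod.coe_alpha_timesMap_id, AeBimod.coe_alpha'_timesMap_id, B.timesComul_incl]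
        exact AeBimod.hom_comm B.comul_whiskerRight h
      counit_right := fun h => (AeBimod.theta_timesMap_id _ _).trans <|
          (B.anchor_t 1 h).trans (by rw [MulOpposite.op_one, map_one]; exact mul_one (M := H) h)
      counit_left := fun h => (AeBimod.theta'_timesMap_id _ _).trans <| (B.anchor_s 1 h).trans (by
        rw [map_one]; exact mul_one (M := H) h) }
  comul_ringMap := by
    obtain ⟨f, hf⟩ := B.comul_alg
    exact ⟨f, fun h => Subtype.ext (hf h),
      fun a => Subtype.ext ((hf _).trans ((comul_s B.comul_alg a).trans (by
        change _ = pure R R (R.s a) (R.t 1)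
        rw [map_one]))),
      fun a => Subtype.ext ((hf _).trans ((comul_t B.comul_alg a).trans (by
        change _ = pure R R (R.s 1) (R.t a)
        rw [map_one])))⟩
  anchor_ringMap := by
    obtain ⟨f, hf⟩ := B.anchor_alg
    exact ⟨f, hf, fun a => (hf _).trans (LinearMap.ext fun x => B.mu_s a x),
      fun a => (hf _).trans (LinearMap.ext fun x => B.mu_t a x)⟩

end AnchoredBialgebroid

/-- Structures of a bialgebroid with an anchor correspond to `×_A`-bialgebra structures. -/
def anchoredEquivTakeuchi (R : AeRing.{v, u} k A H) :
    R.AnchoredBialgebroid ≃ R.TakeuchiBialgebra where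
  toFun := AnchoredBialgebroid.toTakeuchi
  invFun := TakeuchiBialgebra.toAnchored
  left_inv _ := AnchoredBialgebroid.ext' rfl fun _ => rfl
  right_inv _ := TakeuchiBialgebra.ext' (fun _ => rfl) fun _ => rfl

end AeRing

/-! ### Equality of bimodules and modules, and reduction to pure tensors -/

namespace ABimod

variable {k : Type v} [CommRing k] {A : Type u} [Ring A] [Algebra k A]

theorem eqToHom_apply {X Y : ABimod.{v, u} k A} (h : X = Y) (x : X) :
    (eqToHom h) x = cast (congrArg carrier h) x := by
  subst h
  rfl

/-- Strict monoidality asks for equality of objects. Once the carriers are identified, the additive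
group, scalar action and two algebra maps are each determined by their values, and commutation of
the actions is a proposition. -/
theorem eq_of_cast {X Y : ABimod.{v, u} k A} (h : X.carrier = Y.carrier)
    (hadd : ∀ x y : X, cast h (x + y) = cast h x + cast h y)
    (hsmul : ∀ (c : k) (x : X), cast h (c • x) = c • cast h x)
    (hleft : ∀ (a : A) (x : X), cast h (X.left a x) = Y.left a (cast h x))
    (hright : ∀ (a : Aᵐᵒᵖ) (x : X), cast h (X.right a x) = Y.right a (cast h x)) : X = Y := by
  obtain ⟨C, l, r, hlr⟩ := X
  obtain ⟨D, l', r', hlr'⟩ := Y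
  rename_i i₁ i₂ j₁ j₂
  change C = D at h
  subst h
  obtain rfl : i₁ = j₁ := AddCommGroup.ext (funext fun x => funext fun y => hadd x y)
  obtain rfl : i₂ = j₂ := Module.ext' _ _ hsmul
  obtain rfl : l = l' := AlgHom.ext fun a => LinearMap.ext fun x => hleft a x
  obtain rfl : r = r' := AlgHom.ext fun a => LinearMap.ext fun x => hright a x
  rfl

@[simp] theorem hom_inv_apply {X Y : ABimod.{v, u} k A} (e : X ≅ Y) (x : X) :
    e.inv (e.hom x) = x := AeBimod.hom_comm e.hom_inv_id x

@[simp] theorem inv_hom_apply {X Y : ABimod.{v, u} k A} (e : X ≅ Y) (y : Y) :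
    e.hom (e.inv y) = y := AeBimod.hom_comm e.inv_hom_id y

/-- Induction on tensors transported along `e`. It is applied to the subgroup on which a map
commutes with `H`, so that linearity need only be checked on pure tensors. -/
theorem mem_of_tm {X Y Z : ABimod.{v, u} k A} (e : Z ≅ X ⊗ Y) (S : AddSubgroup Z)
    (h : ∀ x y, e.inv (tm x y) ∈ S) (z : Z) : z ∈ S := by
  have key : ∀ w : (X ⊗ Y : ABimod.{v, u} k A), e.inv w ∈ S := fun w => by
    induction w using tens_induction with
    | h0 => rw [map_zero]; exact S.zero_mem
    | ht x y => exact h x y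
    | hadd z w hz hw => rw [map_add]; exact S.add_mem hz hw
  simpa using key (e.hom z)

end ABimod

theorem ModuleCat.eq_of_cast {H : Type u} [Ring H] {P Q : ModuleCat.{u} H}
    (h : (P : Type u) = Q) (hadd : ∀ x y : P, cast h (x + y) = cast h x + cast h y)
    (hsmul : ∀ (c : H) (x : P), cast h (c • x) = c • cast h x) : P = Q := by
  obtain ⟨C⟩ := P
  obtain ⟨D⟩ := Q
  rename_i i₁ i₂ j₁ j₂
  change C = D at h
  subst h
  obtain rfl : i₁ = j₁ := AddCommGroup.ext (funext fun x => funext fun y => hadd x y)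
  obtain rfl : i₂ = j₂ := Module.ext' _ _ hsmul
  rfl

/-! ### Modules through their orbit maps, and actions on tensor products -/

namespace AeRing

variable {k : Type v} [CommRing k] {A : Type u} [Ring A] [Algebra k A]
variable {H : Type u} [Ring H] [Algebra k H] (R : AeRing.{v, u} k A H)

instance : R.forget.Faithful where
  map_injective h := ModuleCat.hom_ext (LinearMap.ext fun x => AeBimod.hom_comm h x)

section orbit

variable {M N P : ModuleCat.{u} H}

theorem act_add (h : H) (m m' : R.forget.obj M) :
    R.act M h (m + m') = R.act M h m + R.act M h m' := smul_add (M := H) (A := M) h m m'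

theorem act_zero (h : H) : R.act M h 0 = 0 := smul_zero (M := H) (A := M) h

theorem act_one (m : R.forget.obj M) : R.act M 1 m = m := one_smul (M := H) (α := M) m

theorem act_mul (g h : H) (m : R.forget.obj M) : R.act M (g * h) m = R.act M g (R.act M h m) :=
  mul_smul (α := H) (β := M) g h m

theorem act_smul (h : H) (c : k) (m : R.forget.obj M) : R.act M h (c • m) = c • R.act M h m := by
  change h • (algebraMap k H c • (show M from m)) = algebraMap k H c • (h • (show M from m))
  rw [← mul_smul, ← mul_smul, Algebra.commutes]

theorem orbit_apply (m : R.forget.obj M) (h : H) : (R.orbit M m) h = R.act M h m := rfl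

/-- This is `H`-linearity of `f`, phrased as an equation of bimodule maps out of `H`. -/
theorem orbit_comp_map (f : M ⟶ N) (m : R.forget.obj M) :
    R.orbit M m ≫ R.forget.map f = R.orbit N (R.forget.map f m) :=
  ABimod.hom_ext fun h => f.hom.map_smul (show H from h) (show M from m)

theorem mulRight_comp_orbit (x : H) (m : R.forget.obj M) :
    R.mulRight x ≫ R.orbit M m = R.orbit M (R.act M x m) :=
  ABimod.hom_ext fun h => R.act_mul h x m

/-- A map of bimodules between `H`-modules that commutes with the actions, as a map of
`H`-modules. -/
def homMk (φ : R.forget.obj M ⟶ R.forget.obj N)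
    (hφ : ∀ m, R.orbit M m ≫ φ = R.orbit N (φ m)) : M ⟶ N :=
  ModuleCat.ofHom
    { toFun := φ.lin
      map_add' := φ.lin.map_add
      map_smul' := fun h m => AeBimod.hom_comm (hφ m) h }

@[simp] theorem forget_map_homMk (φ : R.forget.obj M ⟶ R.forget.obj N)
    (hφ : ∀ m, R.orbit M m ≫ φ = R.orbit N (φ m)) : R.forget.map (R.homMk φ hφ) = φ := rfl

/-- An isomorphism of bimodules between `H`-modules that commutes with the actions, as an
isomorphism of `H`-modules. -/
def isoMk (e : R.forget.obj M ≅ R.forget.obj N)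
    (he : ∀ m, R.orbit M m ≫ e.hom = R.orbit N (e.hom m)) : M ≅ N where
  hom := R.homMk e.hom he
  inv := R.homMk e.inv fun n => by
    rw [Iso.comp_inv_eq, he, ABimod.inv_hom_apply]
  hom_inv_id := R.forget.map_injective (by simp)
  inv_hom_id := R.forget.map_injective (by simp)

/-- The elements at which a map of bimodules commutes with the action of `H`. -/
def commSet (φ : R.forget.obj M ⟶ R.forget.obj N) : AddSubgroup (R.forget.obj M) where
  carrier := {m | R.orbit M m ≫ φ = R.orbit N (φ m)}
  zero_mem' := ABimod.hom_ext fun h => by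
    change φ.lin (R.act M h 0) = R.act N h (φ.lin 0)
    rw [act_zero, map_zero, act_zero]
  add_mem' {m m'} hm hm' := ABimod.hom_ext fun h => by
    have e : φ.lin (R.act M h m) = R.act N h (φ.lin m) := AeBimod.hom_comm hm h
    have e' : φ.lin (R.act M h m') = R.act N h (φ.lin m') := AeBimod.hom_comm hm' h
    change φ.lin (R.act M h (m + m')) = R.act N h (φ.lin (m + m'))
    rw [act_add, map_add, map_add, act_add, e, e']
  neg_mem' {m} hm := ABimod.hom_ext fun h => by
    have e : φ.lin (R.act M h m) = R.act N h (φ.lin m) := AeBimod.hom_comm hm h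
    have e₁ : R.act M h (-m) = -R.act M h m := smul_neg (M := H) (A := M) h m
    have e₂ : R.act N h (-φ.lin m) = -R.act N h (φ.lin m) := smul_neg (M := H) (A := N) h (φ.lin m)
    change φ.lin (R.act M h (-m)) = R.act N h (φ.lin (-m))
    rw [e₁, map_neg, map_neg, e₂, e]

theorem mem_commSet {φ : R.forget.obj M ⟶ R.forget.obj N} {m : R.forget.obj M} :
    m ∈ R.commSet φ ↔ R.orbit M m ≫ φ = R.orbit N (φ m) := Iff.rfl

end orbit

/-- Under `e : T ≅ M ⊗_A N`, the action on `T` is `h (m ⊗ n) = h₍₁₎ m ⊗ h₍₂₎ n`. -/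
def IsTensorAction (comul : R.bimod ⟶ R.bimod ⊗ R.bimod) {M N T : ModuleCat.{u} H}
    (e : R.forget.obj T ≅ R.forget.obj M ⊗ R.forget.obj N) : Prop :=
  ∀ (m : R.forget.obj M) (n : R.forget.obj N),
    R.orbit T (e.inv (ABimod.tm m n)) ≫ e.hom = comul ≫ (R.orbit M m ⊗ₘ R.orbit N n)

/-- Under `e : U ≅ A`, the action on `U` is `h ▷ a = μ(h)(a)`. -/
def IsUnitAction (anchor : R.bimod ⟶ (endRing k A).bimod) {U : ModuleCat.{u} H}
    (e : R.forget.obj U ≅ 𝟙_ (ABimod.{v, u} k A)) : Prop :=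
  ∀ a : A, R.orbit U (e.inv a) ≫ e.hom = anchor ≫ evalAt a

section actions

variable {R} {comul : R.bimod ⟶ R.bimod ⊗ R.bimod} {anchor : R.bimod ⟶ (endRing k A).bimod}
variable {M N P T : ModuleCat.{u} H}

/-- The tensor product of `H`-linear maps is `H`-linear because at `m ⊗ n` both sides are `Δ`
followed by the orbit maps of `f m` and `g n`, by the interchange law. -/
theorem IsTensorAction.orbit_map {M' N' T' : ModuleCat.{u} H}
    {e : R.forget.obj T ≅ R.forget.obj M ⊗ R.forget.obj N} (he : R.IsTensorAction comul e)
    {e' : R.forget.obj T' ≅ R.forget.obj M' ⊗ R.forget.obj N'} (he' : R.IsTensorAction comul e')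
    (f : M ⟶ M') (g : N ⟶ N') (z : R.forget.obj T) :
    R.orbit T z ≫ e.hom ≫ (R.forget.map f ⊗ₘ R.forget.map g) ≫ e'.inv =
      R.orbit T' ((e.hom ≫ (R.forget.map f ⊗ₘ R.forget.map g) ≫ e'.inv) z) := by
  refine ABimod.mem_of_tm e (R.commSet _) (fun m n => ?_) z
  rw [mem_commSet, reassoc_of% he m n, ← Category.assoc, ← Category.assoc, Iso.comp_inv_eq,
    Category.assoc, tensorHom_comp_tensorHom, orbit_comp_map, orbit_comp_map, ← he',
    ABimod.comp_apply,
    ABimod.inv_hom_apply]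
  rfl

/-- The comultiplication leaves no freedom in the action: the identity of `M ⊗_A N` is `H`-linear
between any two modules realizing it. -/
theorem IsTensorAction.orbit_eq {T' : ModuleCat.{u} H}
    {e : R.forget.obj T ≅ R.forget.obj M ⊗ R.forget.obj N} (he : R.IsTensorAction comul e)
    {e' : R.forget.obj T' ≅ R.forget.obj M ⊗ R.forget.obj N} (he' : R.IsTensorAction comul e')
    (x : (R.forget.obj M ⊗ R.forget.obj N : ABimod.{v, u} k A)) :
    R.orbit T (e.inv x) ≫ e.hom = R.orbit T' (e'.inv x) ≫ e'.hom := by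
  have h := he.orbit_map he' (𝟙 M) (𝟙 N) (e.inv x)
  rw [CategoryTheory.Functor.map_id, CategoryTheory.Functor.map_id, id_tensorHom_id,
    Category.id_comp, ← Category.assoc,
    Iso.comp_inv_eq, ABimod.comp_apply, ABimod.inv_hom_apply] at h
  exact h

/-- On `(m ⊗ n) ⊗ p` the element `h` acts through `(Δ ⊗ H) Δ`. The companion for the other
bracketing gives `(H ⊗ Δ) Δ`, so coassociativity and linearity of the associator are compared by a
single pair of formulas. -/
theorem IsTensorAction.orbit_assoc_left {MN MNP : ModuleCat.{u} H}
    {e : R.forget.obj MN ≅ R.forget.obj M ⊗ R.forget.obj N} (he : R.IsTensorAction comul e)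
    {e' : R.forget.obj MNP ≅ R.forget.obj MN ⊗ R.forget.obj P} (he' : R.IsTensorAction comul e')
    (m : R.forget.obj M) (n : R.forget.obj N) (p : R.forget.obj P) :
    R.orbit MNP (e'.inv (ABimod.tm (e.inv (ABimod.tm m n)) p)) ≫ e'.hom ≫
        e.hom ▷ R.forget.obj P ≫ (α_ _ _ _).hom =
      (comul ≫ comul ▷ R.bimod ≫ (α_ R.bimod R.bimod R.bimod).hom) ≫
        (R.orbit M m ⊗ₘ (R.orbit N n ⊗ₘ R.orbit P p)) := by
  rw [reassoc_of% he', ← tensorHom_id, tensorHom_comp_tensorHom_assoc, he, Category.comp_id,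
    Category.assoc, Category.assoc, ← associator_naturality, ← tensorHom_id,
    tensorHom_comp_tensorHom_assoc, Category.id_comp]

theorem IsTensorAction.orbit_assoc_right {NP MNP : ModuleCat.{u} H}
    {e : R.forget.obj NP ≅ R.forget.obj N ⊗ R.forget.obj P} (he : R.IsTensorAction comul e)
    {e' : R.forget.obj MNP ≅ R.forget.obj M ⊗ R.forget.obj NP} (he' : R.IsTensorAction comul e')
    (m : R.forget.obj M) (n : R.forget.obj N) (p : R.forget.obj P) :
    R.orbit MNP (e'.inv (ABimod.tm m (e.inv (ABimod.tm n p)))) ≫ e'.hom ≫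
        R.forget.obj M ◁ e.hom =
      (comul ≫ R.bimod ◁ comul) ≫ (R.orbit M m ⊗ₘ (R.orbit N n ⊗ₘ R.orbit P p)) := by
  rw [reassoc_of% he', ← id_tensorHom, tensorHom_comp_tensorHom, he, Category.comp_id,
    Category.assoc, ← id_tensorHom, tensorHom_comp_tensorHom, Category.id_comp]

/-- After the unitor, `h (a ⊗ m)` becomes `s(h₍₁₎ ▷ a) h₍₂₎ m`. Linearity of the unitor compares
this with `h s(a) m`, which is the first anchor equation applied to `m`. -/
theorem IsTensorAction.orbit_leftUnitor {U : ModuleCat.{u} H}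
    {η : R.forget.obj U ≅ 𝟙_ (ABimod.{v, u} k A)} (hη : R.IsUnitAction anchor η)
    {e : R.forget.obj T ≅ R.forget.obj U ⊗ R.forget.obj M} (he : R.IsTensorAction comul e)
    (a : A) (m : R.forget.obj M) :
    R.orbit T (e.inv (ABimod.tm (η.inv a) m)) ≫ e.hom ≫ η.hom ▷ R.forget.obj M ≫ (λ_ _).hom =
      (comul ≫ (anchor ≫ evalAt a) ▷ R.bimod ≫ (λ_ R.bimod).hom) ≫ R.orbit M m := by
  rw [reassoc_of% he, ← tensorHom_id, tensorHom_comp_tensorHom_assoc, hη, Category.comp_id,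
    Category.assoc, Category.assoc, ← leftUnitor_naturality, tensorHom_def_assoc]

theorem IsTensorAction.orbit_rightUnitor {U : ModuleCat.{u} H}
    {η : R.forget.obj U ≅ 𝟙_ (ABimod.{v, u} k A)} (hη : R.IsUnitAction anchor η)
    {e : R.forget.obj T ≅ R.forget.obj M ⊗ R.forget.obj U} (he : R.IsTensorAction comul e)
    (a : A) (m : R.forget.obj M) :
    R.orbit T (e.inv (ABimod.tm m (η.inv a))) ≫ e.hom ≫ R.forget.obj M ◁ η.hom ≫ (ρ_ _).hom =
      (comul ≫ R.bimod ◁ (anchor ≫ evalAt a) ≫ (ρ_ R.bimod).hom) ≫ R.orbit M m := by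
  rw [reassoc_of% he, ← id_tensorHom, tensorHom_comp_tensorHom_assoc, hη, Category.comp_id,
    Category.assoc, Category.assoc, ← rightUnitor_naturality, tensorHom_def'_assoc]

end actions

end AeRing

/-! ### Transported associators and unitors on pure tensors -/

namespace ABimod

variable {k : Type v} [CommRing k] {A : Type u} [Ring A] [Algebra k A]
variable {X Y Z : ABimod.{v, u} k A}

theorem whiskerRight_tm {X' : ABimod.{v, u} k A} (f : X ⟶ X') (x : X) (y : Y) :
    (f ▷ Y) (tm x y) = tm (f x) y := rfl

theorem whiskerLeft_tm {Y' : ABimod.{v, u} k A} (f : Y ⟶ Y') (x : X) (y : Y) :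
    (X ◁ f) (tm x y) = tm x (f y) := rfl

theorem associator_hom_tm (x : X) (y : Y) (z : Z) :
    (α_ X Y Z).hom (tm (X := X ⊗ Y) (tm x y) z) = tm (Y := Y ⊗ Z) x (tm y z) := rfl

theorem associator_conj_tm {V W S T : ABimod.{v, u} k A} (e₁ : V ≅ X ⊗ Y) (e₂ : S ≅ V ⊗ Z)
    (e₃ : W ≅ Y ⊗ Z) (e₄ : T ≅ X ⊗ W) (x : X) (y : Y) (z : Z) :
    (e₂.hom ≫ e₁.hom ▷ Z ≫ (α_ X Y Z).hom ≫ X ◁ e₃.inv ≫ e₄.inv)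
      (e₂.inv (tm (e₁.inv (tm x y)) z)) = e₄.inv (tm x (e₃.inv (tm y z))) := by
  simp only [comp_apply, inv_hom_apply]
  rw [whiskerRight_tm, inv_hom_apply, associator_hom_tm, whiskerLeft_tm]

theorem leftUnitor_conj_tm {U T : ABimod.{v, u} k A} (η : U ≅ 𝟙_ (ABimod.{v, u} k A))
    (e : T ≅ U ⊗ X) (a : A) (x : X) :
    (e.hom ≫ η.hom ▷ X ≫ (λ_ X).hom) (e.inv (tm (η.inv a) x)) = X.left a x := by
  simp only [comp_apply, inv_hom_apply]
  rw [whiskerRight_tm, inv_hom_apply]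
  rfl

theorem rightUnitor_conj_tm {U T : ABimod.{v, u} k A} (η : U ≅ 𝟙_ (ABimod.{v, u} k A))
    (e : T ≅ X ⊗ U) (a : A) (x : X) :
    (e.hom ≫ X ◁ η.hom ≫ (ρ_ X).hom) (e.inv (tm x (η.inv a))) =
      X.right (MulOpposite.op a) x := by
  simp only [comp_apply, inv_hom_apply]
  rw [whiskerLeft_tm, inv_hom_apply]
  rfl

end ABimod

/-! ### From an anchored bialgebroid to a monoidal structure -/

namespace AeRing

variable {k : Type v} [CommRing k] {A : Type u} [Ring A] [Algebra k A]
variable {H : Type u} [Ring H] [Algebra k H] (R : AeRing.{v, u} k A H)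

section gammaAction

variable (M N : ModuleCat.{u} H)

/-- Multiplying on the right by `c ⊗ d` before evaluating at `m ⊗ n` amounts to evaluating at `c m ⊗
d n`. -/
theorem orbit_tensor_actR (z : (R.bimod ⊗ R.bimod : ABimod.{v, u} k A)) (c d : H)
    (m : R.forget.obj M) (n : R.forget.obj N) :
    (R.orbit M m ⊗ₘ R.orbit N n) (actR R R z (c ⊗ₜ[k] d)) =
      (R.orbit M (R.act M c m) ⊗ₘ R.orbit N (R.act N d n)) z := by
  rw [actR_tmul, ← mulRight_comp_orbit, ← mulRight_comp_orbit, ← tensorHom_comp_tensorHom]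
  rfl

/-- The bilinear map `(m, n) ↦ x¹ m ⊗ x² n`, for `x = ∑ x¹ ⊗ x²`. -/
def orbitBilin (x : (R.bimod ⊗ R.bimod : ABimod.{v, u} k A)) :
    R.forget.obj M →ₗ[k] R.forget.obj N →ₗ[k]
      (R.forget.obj M ⊗ R.forget.obj N : ABimod.{v, u} k A) :=
  LinearMap.mk₂ k (fun m n => (R.orbit M m ⊗ₘ R.orbit N n) x)
    (fun m m' n => LinearMap.congr_fun (ABimod.lin_ext
      (f := (R.orbit M (m + m') ⊗ₘ R.orbit N n).lin)
      (g := (R.orbit M m ⊗ₘ R.orbit N n).lin + (R.orbit M m' ⊗ₘ R.orbit N n).lin)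
      fun g h => (congrArg (fun q => ABimod.tm q (R.act N h n)) (R.act_add g m m')).trans
        (ABimod.add_tm _ _ _)) x)
    (fun c m n => LinearMap.congr_fun (ABimod.lin_ext
      (f := (R.orbit M (c • m) ⊗ₘ R.orbit N n).lin)
      (g := c • (R.orbit M m ⊗ₘ R.orbit N n).lin)
      fun g h => (congrArg (fun q => ABimod.tm q (R.act N h n)) (R.act_smul g c m)).trans
        (ABimod.smul_tm _ _ _)) x)
    (fun m n n' => LinearMap.congr_fun (ABimod.lin_ext
      (f := (R.orbit M m ⊗ₘ R.orbit N (n + n')).lin)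
      (g := (R.orbit M m ⊗ₘ R.orbit N n).lin + (R.orbit M m ⊗ₘ R.orbit N n').lin)
      fun g h => (congrArg (ABimod.tm (R.act M g m)) (R.act_add h n n')).trans
        (ABimod.tm_add _ _ _)) x)
    (fun c m n => LinearMap.congr_fun (ABimod.lin_ext
      (f := (R.orbit M m ⊗ₘ R.orbit N (c • n)).lin)
      (g := c • (R.orbit M m ⊗ₘ R.orbit N n).lin)
      fun g h => (congrArg (ABimod.tm (R.act M g m)) (R.act_smul h c n)).trans
        (ABimod.tm_smul _ _ _)) x)

/-- The action of `H ×_A H` on `M ⊗_A N`, by `x (m ⊗ n) = x¹ m ⊗ x² n`. -/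
def gammaEnd (x : R.gamma) :
    Module.End k (R.forget.obj M ⊗ R.forget.obj N : ABimod.{v, u} k A) :=
  ABimod.lift (R.orbitBilin M N x.1) fun a m n => by
    -- The defining condition of `H ×_A H`, evaluated at `m ⊗ n`, is the balancedness needed to
    -- descend to `M ⊗_A N`.
    have h := (mem_iff R R x.1).1 x.2 a
    have h' := congrArg (R.orbit M m ⊗ₘ R.orbit N n).lin h
    rw [orbit_tensor_actR, orbit_tensor_actR, act_one, act_one] at h'
    exact h'

/-- For `y` in `H ×_A H` this is associativity of the action; letting `y` range over all of `H ⊗_A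
H` reduces the proof to pure tensors. -/
theorem gammaEnd_orbit (x : R.gamma) (y : (R.bimod ⊗ R.bimod : ABimod.{v, u} k A))
    (m : R.forget.obj M) (n : R.forget.obj N) :
    R.gammaEnd M N x ((R.orbit M m ⊗ₘ R.orbit N n) y) =
      (R.orbit M m ⊗ₘ R.orbit N n) (lmulT R R x y) :=
  LinearMap.congr_fun (ABimod.lin_ext
    (f := R.gammaEnd M N x ∘ₗ (R.orbit M m ⊗ₘ R.orbit N n).lin)
    (g := (R.orbit M m ⊗ₘ R.orbit N n).lin ∘ₗ lmulT R R x)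
    fun c d => (R.orbit_tensor_actR M N x.1 c d m n).symm) y

/-- The algebra map giving the action of `H ×_A H` on `M ⊗_A N`. -/
def gammaRep : R.gamma →ₐ[k]
    Module.End k (R.forget.obj M ⊗ R.forget.obj N : ABimod.{v, u} k A) :=
  AlgHom.ofLinearMap
    { toFun := R.gammaEnd M N
      map_add' := fun x y => ABimod.lin_ext fun m n =>
        map_add (R.orbit M m ⊗ₘ R.orbit N n).lin x.1 y.1
      map_smul' := fun c x => ABimod.lin_ext fun m n =>
        map_smul (R.orbit M m ⊗ₘ R.orbit N n).lin c x.1 }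
    (ABimod.lin_ext fun m n => congrArg₂ ABimod.tm (R.act_one m) (R.act_one n))
    (fun x y => ABimod.lin_ext fun m n => (R.gammaEnd_orbit M N x y.1 m n).symm)

theorem gammaRep_tm (x : R.gamma) (m : R.forget.obj M) (n : R.forget.obj N) :
    R.gammaRep M N x (ABimod.tm m n) = (R.orbit M m ⊗ₘ R.orbit N n) x.1 := rfl

end gammaAction

/-- An `H`-module structure on a bimodule given by an algebra map. -/
def moduleOf (X : ABimod.{v, u} k A) (f : H →ₐ[k] Module.End k X) : ModuleCat.{u} H :=
  @ModuleCat.of H _ X _ (Module.compHom X f.toRingHom)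

/-- The carrier is `X` itself, so only the actions must match. The scalars of `k`, which now act
through `H`, do so because `f` is a `k`-algebra map. -/
theorem forget_moduleOf (X : ABimod.{v, u} k A) (f : H →ₐ[k] Module.End k X)
    (hs : ∀ a, f (R.s a) = X.left a) (ht : ∀ a, f (R.t a) = X.right a) :
    R.forget.obj (moduleOf X f) = X :=
  ABimod.eq_of_cast rfl (fun _ _ => rfl)
    (fun c x => LinearMap.congr_fun (AlgHom.commutes f c) x)
    (fun a x => LinearMap.congr_fun (hs a) x)
    (fun a x => LinearMap.congr_fun (ht a) x)

theorem orbit_moduleOf (X : ABimod.{v, u} k A) (f : H →ₐ[k] Module.End k X)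
    (e : R.forget.obj (moduleOf X f) = X) (h : H) (x : X) :
    (R.orbit (moduleOf X f) ((eqToIso e).inv x) ≫ (eqToIso e).hom) h = f h x := by
  change (eqToHom e) (R.act (moduleOf X f) h ((eqToHom e.symm) x)) = f h x
  rw [ABimod.eqToHom_apply, ABimod.eqToHom_apply]
  rfl

/-- Tensor products of `H`-modules and a unit `H`-module, on which the action is given by a
comultiplication and an anchor. -/
structure TensorData (comul : R.bimod ⟶ R.bimod ⊗ R.bimod)
    (anchor : R.bimod ⟶ (endRing k A).bimod) where
  tensorMod : ModuleCat.{u} H → ModuleCat.{u} H → ModuleCat.{u} H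
  unitMod : ModuleCat.{u} H
  tensorIso : ∀ M N, R.forget.obj (tensorMod M N) ≅ R.forget.obj M ⊗ R.forget.obj N
  unitIso : R.forget.obj unitMod ≅ 𝟙_ (ABimod.{v, u} k A)
  isTensorAction : ∀ M N, R.IsTensorAction comul (tensorIso M N)
  isUnitAction : R.IsUnitAction anchor unitIso

namespace TensorData

variable {R} {B : AnchoredBialgebroid R} (D : R.TensorData B.comul B.anchor)

/-- The tensor product of maps of `H`-modules. -/
def tensorModMap {M M' N N' : ModuleCat.{u} H} (f : M ⟶ M') (g : N ⟶ N') :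
    D.tensorMod M N ⟶ D.tensorMod M' N' :=
  R.homMk ((D.tensorIso M N).hom ≫ (R.forget.map f ⊗ₘ R.forget.map g) ≫ (D.tensorIso M' N').inv)
    ((D.isTensorAction M N).orbit_map (D.isTensorAction M' N') f g)

theorem forget_map_tensorModMap {M M' N N' : ModuleCat.{u} H} (f : M ⟶ M') (g : N ⟶ N') :
    R.forget.map (D.tensorModMap f g) = (D.tensorIso M N).hom ≫
      (R.forget.map f ⊗ₘ R.forget.map g) ≫ (D.tensorIso M' N').inv := rfl

/-- The associator, on underlying bimodules. -/
def assocIso (M N P : ModuleCat.{u} H) :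
    R.forget.obj (D.tensorMod (D.tensorMod M N) P) ≅
      R.forget.obj (D.tensorMod M (D.tensorMod N P)) :=
  D.tensorIso _ _ ≪≫ whiskerRightIso (D.tensorIso M N) _ ≪≫ α_ _ _ _ ≪≫
    whiskerLeftIso _ (D.tensorIso N P).symm ≪≫ (D.tensorIso _ _).symm

/-- The associator. -/
def assocMod (M N P : ModuleCat.{u} H) :
    D.tensorMod (D.tensorMod M N) P ≅ D.tensorMod M (D.tensorMod N P) :=
  R.isoMk (D.assocIso M N P) fun z => by
    refine ABimod.mem_of_tm (D.tensorIso _ P) (R.commSet _) (fun w p => ?_) z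
    have key : ∀ m n, (D.tensorIso (D.tensorMod M N) P).inv (ABimod.tm
        ((D.tensorIso M N).inv (ABimod.tm m n)) p) ∈ R.commSet (D.assocIso M N P).hom :=
      fun m n => by
        have e₁ := (D.isTensorAction M N).orbit_assoc_left
          (D.isTensorAction _ P) m n p
        have e₂ := (D.isTensorAction N P).orbit_assoc_right
          (D.isTensorAction M _) m n p
        -- Coassociativity identifies the orbits for the two bracketings.
        rw [B.coassoc, ← e₂] at e₁
        have e₃ : (D.assocIso M N P).hom ((D.tensorIso (D.tensorMod M N) P).inv (ABimod.tm
            ((D.tensorIso M N).inv (ABimod.tm m n)) p)) =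
            (D.tensorIso M (D.tensorMod N P)).inv (ABimod.tm m
              ((D.tensorIso N P).inv (ABimod.tm n p))) :=
          ABimod.associator_conj_tm _ _ _ _ m n p
        rw [mem_commSet, e₃, ← cancel_mono (D.tensorIso _ _).hom,
          ← cancel_mono (R.forget.obj M ◁ (D.tensorIso N P).hom)]
        simp only [Category.assoc]
        rw [← e₁]
        simp [assocIso]
    -- Second reduction to pure tensors: for fixed `p`, the `w` for which `w ⊗ p` is a good element
    -- form a subgroup.
    exact ABimod.mem_of_tm (D.tensorIso M N) ((R.commSet (D.assocIso M N P).hom).comap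
      ((D.tensorIso (D.tensorMod M N) P).inv.lin ∘ₗ
        (ABimod.tmBilin _ _).flip p).toAddMonoidHom) key w

/-- The left unitor, on underlying bimodules. -/
def leftUnitIso (M : ModuleCat.{u} H) :
    R.forget.obj (D.tensorMod D.unitMod M) ≅ R.forget.obj M :=
  D.tensorIso _ _ ≪≫ whiskerRightIso D.unitIso _ ≪≫ λ_ _

/-- The right unitor, on underlying bimodules. -/
def rightUnitIso (M : ModuleCat.{u} H) :
    R.forget.obj (D.tensorMod M D.unitMod) ≅ R.forget.obj M :=
  D.tensorIso _ _ ≪≫ whiskerLeftIso _ D.unitIso ≪≫ ρ_ _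

/-- The left unitor. -/
def leftUnitMod (M : ModuleCat.{u} H) : D.tensorMod D.unitMod M ≅ M :=
  R.isoMk (D.leftUnitIso M) fun z => by
    refine ABimod.mem_of_tm (D.tensorIso _ M) (R.commSet _) (fun w m => ?_) z
    obtain ⟨a, rfl⟩ : ∃ a, D.unitIso.inv a = w := ⟨D.unitIso.hom w, by simp⟩
    have e₁ := (D.isTensorAction _ M).orbit_leftUnitor D.isUnitAction a m
    -- The anchor equation for all `h` at once, as an equality of bimodule maps.
    have e₂ : B.comul ≫ (B.anchor ≫ evalAt a) ▷ R.bimod ≫ (λ_ R.bimod).hom =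
        R.mulRight (R.s a) := ABimod.hom_ext (B.anchor_s a)
    rw [e₂, mulRight_comp_orbit] at e₁
    exact e₁.trans (congrArg (R.orbit M) (ABimod.leftUnitor_conj_tm _ _ a m).symm)

/-- The right unitor. -/
def rightUnitMod (M : ModuleCat.{u} H) : D.tensorMod M D.unitMod ≅ M :=
  R.isoMk (D.rightUnitIso M) fun z => by
    refine ABimod.mem_of_tm (D.tensorIso M _) (R.commSet _) (fun m w => ?_) z
    obtain ⟨a, rfl⟩ : ∃ a, D.unitIso.inv a = w := ⟨D.unitIso.hom w, by simp⟩
    have e₁ := (D.isTensorAction M _).orbit_rightUnitor D.isUnitAction a m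
    have e₂ : B.comul ≫ R.bimod ◁ (B.anchor ≫ evalAt a) ≫ (ρ_ R.bimod).hom =
        R.mulRight (R.t (MulOpposite.op a)) := ABimod.hom_ext (B.anchor_t a)
    rw [e₂, mulRight_comp_orbit] at e₁
    exact e₁.trans (congrArg (R.orbit M) (ABimod.rightUnitor_conj_tm _ _ a m).symm)

/-- The monoidal structure on `H`-modules given by a bialgebroid with an anchor: the data. -/
@[reducible]
def monoidalStruct : MonoidalCategoryStruct (ModuleCat.{u} H) where
  tensorObj := D.tensorMod
  whiskerLeft M _ _ f := D.tensorModMap (𝟙 M) f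
  whiskerRight f N := D.tensorModMap f (𝟙 N)
  tensorHom := D.tensorModMap
  tensorUnit := D.unitMod
  associator := D.assocMod
  leftUnitor := D.leftUnitMod
  rightUnitor := D.rightUnitMod

theorem forget_map_assocMod (M N P : ModuleCat.{u} H) :
    R.forget.map (D.assocMod M N P).hom =
      (D.tensorIso _ P).hom ≫ (D.tensorIso M N).hom ▷ R.forget.obj P ≫ (α_ _ _ _).hom ≫
        R.forget.obj M ◁ (D.tensorIso N P).inv ≫ (D.tensorIso M _).inv := rfl

theorem forget_map_leftUnitMod (M : ModuleCat.{u} H) :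
    R.forget.map (D.leftUnitMod M).hom =
      (D.tensorIso _ M).hom ≫ D.unitIso.hom ▷ R.forget.obj M ≫ (λ_ _).hom := rfl

theorem forget_map_rightUnitMod (M : ModuleCat.{u} H) :
    R.forget.map (D.rightUnitMod M).hom =
      (D.tensorIso M _).hom ≫ R.forget.obj M ◁ D.unitIso.hom ≫ (ρ_ _).hom := rfl

/-- The comparison of the two tensor products. -/
def inducingData : letI := D.monoidalStruct; Monoidal.InducingFunctorData R.forget :=
  letI := D.monoidalStruct
  { μIso := fun M N => (D.tensorIso M N).symm
    whiskerLeft_eq := fun M _ _ f => by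
      rw [← id_tensorHom, ← R.forget.map_id]
      rfl
    whiskerRight_eq := fun f N => by
      rw [← tensorHom_id, ← R.forget.map_id]
      rfl
    tensorHom_eq := fun _ _ => rfl
    εIso := D.unitIso.symm
    associator_eq := fun M N P => (D.forget_map_assocMod M N P).trans (by simp; rfl)
    leftUnitor_eq := fun M => (D.forget_map_leftUnitMod M).trans (by simp; rfl)
    rightUnitor_eq := fun M => (D.forget_map_rightUnitMod M).trans (by simp; rfl) }

/-- The monoidal structure on `H`-modules given by a bialgebroid with an anchor. -/
@[reducible]
def monoidal : MonoidalCategory (ModuleCat.{u} H) :=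
  letI := D.monoidalStruct
  -- All coherence and naturality axioms are reflected by the faithful forgetful functor.
  Monoidal.induced R.forget D.inducingData

/-- The monoidal structure on `H`-modules given by a bialgebroid with an anchor, when the
identifications of the underlying bimodules are equalities. -/
def toLift (hT : ∀ M N, R.forget.obj (D.tensorMod M N) = R.forget.obj M ⊗ R.forget.obj N)
    (hU : R.forget.obj D.unitMod = 𝟙_ (ABimod.{v, u} k A))
    (hT' : ∀ M N, D.tensorIso M N = eqToIso (hT M N)) (hU' : D.unitIso = eqToIso hU) :
    StrictMonoidalLift R where
  monoidal := D.monoidal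
  strict :=
    letI := D.monoidal
    { obj_tensor := hT
      obj_unit := hU
      map_tensor := fun {M M' N N'} f g => by
        refine (D.forget_map_tensorModMap f g).trans ?_
        rw [hT', hT']
        rfl
      map_associator := fun M N P => by
        refine (D.forget_map_assocMod M N P).trans ?_
        rw [hT', hT', hT', hT']
        rfl
      map_leftUnitor := fun M => by
        refine (D.forget_map_leftUnitMod M).trans ?_
        rw [hT', hU']
        rfl
      map_rightUnitor := fun M => by
        refine (D.forget_map_rightUnitMod M).trans ?_
        rw [hT', hU']
        rfl }

end TensorData

namespace AnchoredBialgebroid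

variable {R} (B : AnchoredBialgebroid R)

/-- The comultiplication as an algebra map to `H ×_A H`. -/
noncomputable def gammaHom : H →ₐ[k] R.gamma := Classical.choose B.comul_alg

theorem coe_gammaHom (h : H) : (B.gammaHom h).1 = B.comul h := Classical.choose_spec B.comul_alg h

/-- The anchor as an algebra map. -/
noncomputable def endHom : H →ₐ[k] Module.End k A := Classical.choose B.anchor_alg

theorem endHom_apply (h : H) : B.endHom h = B.mu h := Classical.choose_spec B.anchor_alg h

/-- The `H`-module `M ⊗_A N`. -/
noncomputable def tensorMod (M N : ModuleCat.{u} H) : ModuleCat.{u} H :=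
  moduleOf (R.forget.obj M ⊗ R.forget.obj N : ABimod.{v, u} k A)
    ((R.gammaRep M N).comp B.gammaHom)

/-- The `H`-module `A`. -/
noncomputable def unitMod : ModuleCat.{u} H :=
  moduleOf (𝟙_ (ABimod.{v, u} k A)) B.endHom

/-- The bimodule structure obtained from the new action is the usual one since `Δ(s(a)) = s(a) ⊗ 1`
and `Δ(t(a)) = 1 ⊗ t(a)`. -/
theorem forget_tensorMod (M N : ModuleCat.{u} H) :
    R.forget.obj (B.tensorMod M N) = R.forget.obj M ⊗ R.forget.obj N :=
  R.forget_moduleOf _ _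
    (fun a => ABimod.lin_ext fun m n => by
      change (R.orbit M m ⊗ₘ R.orbit N n) (B.gammaHom (R.s a)).1 = _
      rw [coe_gammaHom, comul_s B.comul_alg]
      exact congrArg (ABimod.tm (R.act M (R.s a) m)) (R.act_one n))
    (fun a => ABimod.lin_ext fun m n => by
      change (R.orbit M m ⊗ₘ R.orbit N n) (B.gammaHom (R.t a)).1 = _
      rw [coe_gammaHom, comul_t B.comul_alg]
      exact congrArg (fun q => ABimod.tm q (R.act N (R.t a) n)) (R.act_one m))

theorem forget_unitMod : R.forget.obj B.unitMod = 𝟙_ (ABimod.{v, u} k A) :=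
  R.forget_moduleOf _ _
    (fun a => by rw [endHom_apply]; exact LinearMap.ext fun x => B.mu_s a x)
    (fun a => by rw [endHom_apply]; exact LinearMap.ext fun x => B.mu_t a x)

/-- The tensor products of `H`-modules given by a bialgebroid with an anchor. -/
noncomputable def tensorData : R.TensorData B.comul B.anchor where
  tensorMod := B.tensorMod
  unitMod := B.unitMod
  tensorIso M N := eqToIso (B.forget_tensorMod M N)
  unitIso := eqToIso B.forget_unitMod
  isTensorAction M N m n := ABimod.hom_ext fun h =>
    (R.orbit_moduleOf _ _ (B.forget_tensorMod M N) h (ABimod.tm m n)).trans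
      ((R.gammaRep_tm M N (B.gammaHom h) m n).trans
        (congrArg (R.orbit M m ⊗ₘ R.orbit N n).lin (B.coe_gammaHom h)))
  isUnitAction a := ABimod.hom_ext fun h =>
    (R.orbit_moduleOf _ _ B.forget_unitMod h a).trans (LinearMap.congr_fun (B.endHom_apply h) a)

/-- A bialgebroid with an anchor gives a monoidal structure on the category of `H`-modules. -/
noncomputable def toLift : StrictMonoidalLift R :=
  B.tensorData.toLift B.forget_tensorMod B.forget_unitMod (fun _ _ => rfl) rfl

end AnchoredBialgebroid

end AeRing

/-! ### Reconstruction of the comultiplication and the anchor from a monoidal structure -/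

namespace AeRing

variable {k : Type v} [CommRing k] {A : Type u} [Ring A] [Algebra k A]
variable {H : Type u} [Ring H] [Algebra k H] (R : AeRing.{v, u} k A H)

/-- The bimodule `H` is the underlying bimodule of the regular `H`-module. -/
def regIso : R.bimod ≅ R.forget.obj (ModuleCat.of H H) where
  hom := R.orbit (ModuleCat.of H H) (1 : H)
  inv :=
    { lin :=
        { toFun := fun h => (show H from h)
          map_add' := fun _ _ => rfl
          map_smul' := fun c h => (Algebra.smul_def c (show H from h)).symm }
      map_left := fun _ _ => rfl
      map_right := fun _ _ => rfl }
  hom_inv_id := ABimod.hom_ext fun h => mul_one (M := H) h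
  inv_hom_id := ABimod.hom_ext fun h => mul_one (M := H) h

/-- An element of `H`, as an element of the regular `H`-module. -/
def reg (h : H) : R.forget.obj (ModuleCat.of H H) := h

theorem regIso_hom_apply (h : H) : R.regIso.hom h = R.reg h := mul_one (M := H) h

theorem act_reg_one (h : H) : R.act (ModuleCat.of H H) h (R.reg 1) = R.reg h :=
  mul_one (M := H) h

theorem orbit_reg_one : R.orbit (ModuleCat.of H H) (R.reg 1) = R.regIso.hom := rfl

theorem orbit_reg (x : H) :
    R.orbit (ModuleCat.of H H) (R.reg x) = R.mulRight x ≫ R.regIso.hom := by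
  rw [← orbit_reg_one, mulRight_comp_orbit, act_reg_one]

/-- The balancing relation at `1 ⊗ 1`. Acting on it by `h` is what forces `Δ(h)` into `H ×_A H`. -/
theorem reg_balanced (b : A) :
    ABimod.tm (R.reg (R.t (MulOpposite.op b))) (R.reg 1) =
      ABimod.tm (R.reg 1) (R.reg (R.s b)) := by
  rw [← act_reg_one, ← act_reg_one R (R.s b)]
  exact ABimod.tm_balanced b (R.reg 1) (R.reg 1)

/-- The map of `H`-modules `H → M`, `h ↦ h m`. -/
def orbitHom (M : ModuleCat.{u} H) (m : R.forget.obj M) : ModuleCat.of H H ⟶ M :=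
  ModuleCat.ofHom (LinearMap.toSpanSingleton H M m)

theorem forget_map_orbitHom (M : ModuleCat.{u} H) (m : R.forget.obj M) :
    R.forget.map (R.orbitHom M m) = R.regIso.inv ≫ R.orbit M m := rfl

theorem forget_map_orbitHom_reg_one (M : ModuleCat.{u} H) (m : R.forget.obj M) :
    R.forget.map (R.orbitHom M m) (R.reg 1) = m := one_smul (M := H) (α := M) m

section reconstruct

variable {R} {comul : R.bimod ⟶ R.bimod ⊗ R.bimod} {anchor : R.bimod ⟶ (endRing k A).bimod}
variable {T U : ModuleCat.{u} H}
  {e : R.forget.obj T ≅ R.forget.obj (ModuleCat.of H H) ⊗ R.forget.obj (ModuleCat.of H H)}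
  {η : R.forget.obj U ≅ 𝟙_ (ABimod.{v, u} k A)}

theorem IsTensorAction.orbit_reg_comp (he : R.IsTensorAction comul e) (c d : H) :
    R.orbit T (e.inv (ABimod.tm (R.reg c) (R.reg d))) ≫ e.hom =
      comul ≫ (R.mulRight c ⊗ₘ R.mulRight d) ≫ (R.regIso.hom ⊗ₘ R.regIso.hom) := by
  rw [he, tensorHom_comp_tensorHom, ← orbit_reg, ← orbit_reg]

theorem IsTensorAction.orbit_reg_one_comp (he : R.IsTensorAction comul e) :
    R.orbit T (e.inv (ABimod.tm (R.reg 1) (R.reg 1))) ≫ e.hom =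
      comul ≫ (R.regIso.hom ⊗ₘ R.regIso.hom) := he _ _

/-- The elements `h (t(b) ⊗ 1)` and `h (1 ⊗ s(b))` agree; written out through `Δ` they are the two
sides of the condition defining `H ×_A H`. -/
theorem IsTensorAction.comul_mem (he : R.IsTensorAction comul e) (h : H) :
    comul h ∈ R.gamma := by
  refine (mem_iff R R _).2 fun b => ?_
  rw [actR_tmul, actR_tmul]
  have e₁ := he.orbit_reg_comp (R.t (MulOpposite.op b)) 1
  have e₂ := he.orbit_reg_comp 1 (R.s b)
  rw [reg_balanced, e₂, ← Category.assoc, ← Category.assoc, cancel_mono] at e₁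
  exact (AeBimod.hom_comm e₁ h).symm

/-- From `h (c ⊗ d) = h₍₁₎ c ⊗ h₍₂₎ d`, the action on `H ⊗_A H` is left multiplication by `Δ(h)`. -/
theorem IsTensorAction.act_reg (he : R.IsTensorAction comul e) (h : H)
    (y : (R.bimod ⊗ R.bimod : ABimod.{v, u} k A)) :
    e.hom (R.act T h (e.inv ((R.regIso.hom ⊗ₘ R.regIso.hom) y))) =
      (R.regIso.hom ⊗ₘ R.regIso.hom) (lmulT R R ⟨comul h, he.comul_mem h⟩ y) := by
  induction y using ABimod.tens_induction with
  | h0 => simp only [map_zero, act_zero]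
  | ht c d =>
    rw [ABimod.tensorHom_tm, regIso_hom_apply, regIso_hom_apply]
    refine (AeBimod.hom_comm (he.orbit_reg_comp c d) h).trans ?_
    exact congrArg (R.regIso.hom ⊗ₘ R.regIso.hom).lin (actR_tmul R R (comul h) c d).symm
  | hadd z w hz hw => simp only [map_add, act_add, hz, hw]

theorem regIso_tensor_injective : Function.Injective
    (R.regIso.hom ⊗ₘ R.regIso.hom : (R.bimod ⊗ R.bimod : ABimod.{v, u} k A) ⟶ _) := by
  intro x y h
  have := congrArg (R.regIso ⊗ᵢ R.regIso).inv.lin h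
  exact (ABimod.hom_inv_apply (R.regIso ⊗ᵢ R.regIso) x).symm.trans
    (this.trans (ABimod.hom_inv_apply (R.regIso ⊗ᵢ R.regIso) y))

/-- Since `Δ(h) = h (1 ⊗ 1)`, one has `Δ(gh) = g (h (1 ⊗ 1)) = g Δ(h) = Δ(g) Δ(h)`, the last
equality by `act_reg`. -/
theorem IsTensorAction.comul_alg (he : R.IsTensorAction comul e) :
    ∃ f : H →ₐ[k] R.gamma, ∀ h : H, (f h).1 = comul h := by
  have h₁ : ∀ h : H, (R.regIso.hom ⊗ₘ R.regIso.hom) (comul h) =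
      e.hom (R.act T h (e.inv (ABimod.tm (R.reg 1) (R.reg 1)))) := fun h =>
    (AeBimod.hom_comm he.orbit_reg_one_comp h).symm
  refine ⟨AlgHom.ofLinearMap (comul.lin.codRestrict _ he.comul_mem) ?_ ?_, fun h => rfl⟩
  · refine Subtype.ext (regIso_tensor_injective ?_)
    refine (h₁ 1).trans ?_
    rw [act_one, ABimod.inv_hom_apply, ← regIso_hom_apply]
    rfl
  · intro g h
    refine Subtype.ext (regIso_tensor_injective ?_)
    refine (h₁ (g * h)).trans ?_
    rw [act_mul, ← ABimod.hom_inv_apply e (R.act T h _), ← h₁, he.act_reg]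
    rfl

theorem IsUnitAction.anchor_alg (hη : R.IsUnitAction anchor η) :
    ∃ f : H →ₐ[k] Module.End k A, ∀ h : H, f h = anchor h := by
  have h₁ : ∀ (h : H) (a : A), (show Module.End k A from anchor h) a =
      η.hom (R.act U h (η.inv a)) := fun h a => (AeBimod.hom_comm (hη a) h).symm
  refine ⟨AlgHom.ofLinearMap anchor.lin (LinearMap.ext fun a => ?_) fun g h =>
    LinearMap.ext fun a => ?_, fun h => rfl⟩
  · refine (h₁ 1 a).trans ?_
    rw [act_one, ABimod.inv_hom_apply]
    rfl
  · refine (h₁ (g * h) a).trans ?_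
    refine Eq.trans ?_ (h₁ g ((show Module.End k A from anchor h) a)).symm
    rw [h₁ h a, ABimod.hom_inv_apply, act_mul]

end reconstruct

namespace StrictMonoidalLift

variable {R} (L : StrictMonoidalLift R)

/-- The tensor product of `H`-modules. -/
def tensorMod (M N : ModuleCat.{u} H) : ModuleCat.{u} H := L.monoidal.tensorObj M N

/-- The unit `H`-module. -/
def unitMod : ModuleCat.{u} H := L.monoidal.tensorUnit

theorem forget_tensorMod (M N : ModuleCat.{u} H) :
    R.forget.obj (L.tensorMod M N) = R.forget.obj M ⊗ R.forget.obj N := by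
  let := L.monoidal
  exact L.strict.obj_tensor M N

theorem forget_unitMod : R.forget.obj L.unitMod = 𝟙_ (ABimod.{v, u} k A) := by
  let := L.monoidal
  exact L.strict.obj_unit

/-- The identification of the underlying bimodule of a tensor product of `H`-modules. -/
def tensorIso (M N : ModuleCat.{u} H) :
    R.forget.obj (L.tensorMod M N) ≅ R.forget.obj M ⊗ R.forget.obj N :=
  eqToIso (L.forget_tensorMod M N)

/-- The identification of the underlying bimodule of the unit object. -/
def unitIso : R.forget.obj L.unitMod ≅ 𝟙_ (ABimod.{v, u} k A) :=
  eqToIso L.forget_unitMod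

/-- The tensor product of maps of `H`-modules. -/
def tensorModMap {M M' N N' : ModuleCat.{u} H} (f : M ⟶ M') (g : N ⟶ N') :
    L.tensorMod M N ⟶ L.tensorMod M' N' := L.monoidal.tensorHom f g

theorem forget_map_tensorModMap {M M' N N' : ModuleCat.{u} H} (f : M ⟶ M') (g : N ⟶ N') :
    R.forget.map (L.tensorModMap f g) =
      (L.tensorIso M N).hom ≫ (R.forget.map f ⊗ₘ R.forget.map g) ≫ (L.tensorIso M' N').inv := by
  let := L.monoidal
  exact L.strict.map_tensor f g

/-- The associator. -/
def assocMod (M N P : ModuleCat.{u} H) :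
    L.tensorMod (L.tensorMod M N) P ≅ L.tensorMod M (L.tensorMod N P) :=
  L.monoidal.associator M N P

theorem forget_map_assocMod (M N P : ModuleCat.{u} H) :
    R.forget.map (L.assocMod M N P).hom =
      (L.tensorIso _ P).hom ≫ (L.tensorIso M N).hom ▷ R.forget.obj P ≫ (α_ _ _ _).hom ≫
        R.forget.obj M ◁ (L.tensorIso N P).inv ≫ (L.tensorIso M _).inv := by
  let := L.monoidal
  exact L.strict.map_associator M N P

/-- The left unitor. -/
def leftUnitMod (M : ModuleCat.{u} H) : L.tensorMod L.unitMod M ≅ M := L.monoidal.leftUnitor M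

theorem forget_map_leftUnitMod (M : ModuleCat.{u} H) :
    R.forget.map (L.leftUnitMod M).hom =
      (L.tensorIso _ M).hom ≫ L.unitIso.hom ▷ R.forget.obj M ≫ (λ_ _).hom := by
  let := L.monoidal
  exact L.strict.map_leftUnitor M

/-- The right unitor. -/
def rightUnitMod (M : ModuleCat.{u} H) : L.tensorMod M L.unitMod ≅ M := L.monoidal.rightUnitor M

theorem forget_map_rightUnitMod (M : ModuleCat.{u} H) :
    R.forget.map (L.rightUnitMod M).hom =
      (L.tensorIso M _).hom ≫ R.forget.obj M ◁ L.unitIso.hom ≫ (ρ_ _).hom := by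
  let := L.monoidal
  exact L.strict.map_rightUnitor M

/-- The comultiplication `h ↦ h (1 ⊗ 1)`. -/
def comul : R.bimod ⟶ R.bimod ⊗ R.bimod :=
  R.orbit _ ((L.tensorIso (ModuleCat.of H H) (ModuleCat.of H H)).inv
      (ABimod.tm (R.reg 1) (R.reg 1))) ≫
    (L.tensorIso _ _).hom ≫ (R.regIso.inv ⊗ₘ R.regIso.inv)

/-- The anchor, given by the action on the unit object. -/
def anchor : R.bimod ⟶ (endRing k A).bimod where
  lin := LinearMap.mk₂ k
    (fun (h : H) (a : A) => (L.unitIso.hom (R.act _ h (L.unitIso.inv a)) : A))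
    (fun g h a => map_add (R.orbit _ (L.unitIso.inv a) ≫ L.unitIso.hom).lin g h)
    (fun c h a => map_smul (R.orbit _ (L.unitIso.inv a) ≫ L.unitIso.hom).lin c h)
    (fun h a b => by rw [map_add, act_add]; exact map_add L.unitIso.hom.lin _ _)
    (fun c h a => by rw [map_smul, act_smul]; exact map_smul L.unitIso.hom.lin _ _)
  map_left b h := LinearMap.ext fun a =>
    (R.orbit _ (L.unitIso.inv a) ≫ L.unitIso.hom).map_left b h
  map_right b h := LinearMap.ext fun a =>
    (R.orbit _ (L.unitIso.inv a) ≫ L.unitIso.hom).map_right b h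

theorem isUnitAction : R.IsUnitAction L.anchor L.unitIso := fun _ => rfl

/-- The tensor product of the `H`-linear maps `H → M` and `H → N` sending `1` to `m` and `n` is
`H`-linear and takes `1 ⊗ 1` to `m ⊗ n`, so it carries `h (1 ⊗ 1) = Δ(h)` to `h (m ⊗ n)`. -/
theorem isTensorAction (M N : ModuleCat.{u} H) : R.IsTensorAction L.comul (L.tensorIso M N) := by
  intro m n
  have h₁ : R.forget.map (L.tensorModMap (R.orbitHom M m) (R.orbitHom N n))
      ((L.tensorIso (ModuleCat.of H H) (ModuleCat.of H H)).inv
        (ABimod.tm (R.reg 1) (R.reg 1))) = (L.tensorIso M N).inv (ABimod.tm m n) := by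
    rw [forget_map_tensorModMap, ABimod.comp_apply, ABimod.comp_apply, ABimod.inv_hom_apply,
      ABimod.tensorHom_tm, forget_map_orbitHom_reg_one, forget_map_orbitHom_reg_one]
  rw [← h₁]
  refine (congrArg (· ≫ (L.tensorIso M N).hom)
    (R.orbit_comp_map (L.tensorModMap (R.orbitHom M m) (R.orbitHom N n)) _).symm).trans ?_
  rw [forget_map_tensorModMap, forget_map_orbitHom, forget_map_orbitHom]
  simp [comul]

/-- A lift of the monoidal structure gives a bialgebroid with an anchor. -/
def toAnchored : AnchoredBialgebroid R where
  comul := L.comul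
  anchor := L.anchor
  comul_alg := (L.isTensorAction (ModuleCat.of H H) (ModuleCat.of H H)).comul_alg
  anchor_alg := L.isUnitAction.anchor_alg
  coassoc := by
    let X := ModuleCat.of H H
    have e₁ := (L.isTensorAction X X).orbit_assoc_left (L.isTensorAction _ X)
      (R.reg 1) (R.reg 1) (R.reg 1)
    have e₂ := (L.isTensorAction X X).orbit_assoc_right (L.isTensorAction X _)
      (R.reg 1) (R.reg 1) (R.reg 1)
    -- The associator sends `(1 ⊗ 1) ⊗ 1` to `1 ⊗ (1 ⊗ 1)` and is `H`-linear, so the two iterated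
    -- comultiplications agree.
    rw [← ABimod.associator_conj_tm (L.tensorIso X X) (L.tensorIso _ X),
      ← forget_map_assocMod, ← orbit_comp_map, forget_map_assocMod] at e₂
    rw [orbit_reg_one] at e₁ e₂
    rw [← cancel_mono (R.regIso.hom ⊗ₘ R.regIso.hom ⊗ₘ R.regIso.hom), ← e₁, ← e₂]
    simp
  anchor_s a h := by
    have e₁ := (L.isTensorAction _ (ModuleCat.of H H)).orbit_leftUnitor L.isUnitAction a (R.reg 1)
    -- The left unitor is `H`-linear and sends `a ⊗ 1` to `s(a)`, so it sends `h (a ⊗ 1)` to `h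
    -- s(a)`.
    rw [← forget_map_leftUnitMod, orbit_comp_map, forget_map_leftUnitMod,
      ABimod.leftUnitor_conj_tm] at e₁
    have e₂ := (R.mulRight_comp_orbit (R.s a) (R.reg 1)).trans e₁
    rw [orbit_reg_one, cancel_mono] at e₂
    exact (AeBimod.hom_comm e₂ h).symm
  anchor_t a h := by
    have e₁ := (L.isTensorAction (ModuleCat.of H H) _).orbit_rightUnitor L.isUnitAction a (R.reg 1)
    rw [← forget_map_rightUnitMod, orbit_comp_map, forget_map_rightUnitMod,
      ABimod.rightUnitor_conj_tm] at e₁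
    have e₂ := (R.mulRight_comp_orbit (R.t (MulOpposite.op a)) (R.reg 1)).trans e₁
    rw [orbit_reg_one, cancel_mono] at e₂
    exact (AeBimod.hom_comm e₂ h).symm

end StrictMonoidalLift

end AeRing

/-! ### Uniqueness and the bijection between anchored bialgebroids and monoidal structures -/

/-- Two monoidal structures for which a faithful functor is strict monoidal agree if they agree on
objects. -/
theorem IsStrictMonoidal.monoidalCategory_eq {C : Type*} [Category C] {D : Type*} [Category D]
    [MonoidalCategory D] (F : C ⥤ D) [F.Faithful] (m m' : MonoidalCategory C)
    (s : @IsStrictMonoidal C _ m D _ _ F) (s' : @IsStrictMonoidal C _ m' D _ _ F)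
    (hT : ∀ X Y : C, m.tensorObj X Y = m'.tensorObj X Y) (hU : m.tensorUnit = m'.tensorUnit) :
    m = m' := by
  -- Strictness constrains only tensor products of maps; the whiskerings are recovered as tensor
  -- products with identities.
  have hl := fun (X : C) {Y Y' : C} (f : Y ⟶ Y') => (@id_tensorHom C _ m X Y Y' f).symm
  have hr := fun {X X' : C} (f : X ⟶ X') (Y : C) => (@tensorHom_id C _ m X X' f Y).symm
  have hl' := fun (X : C) {Y Y' : C} (f : Y ⟶ Y') => (@id_tensorHom C _ m' X Y Y' f).symm
  have hr' := fun {X X' : C} (f : X ⟶ X') (Y : C) => (@tensorHom_id C _ m' X X' f Y).symm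
  have ht := fun {X X' Y Y' : C} (f : X ⟶ X') (g : Y ⟶ Y') =>
    @IsStrictMonoidal.map_tensor C _ m D _ _ F s X X' Y Y' f g
  have ht' := fun {X X' Y Y' : C} (f : X ⟶ X') (g : Y ⟶ Y') =>
    @IsStrictMonoidal.map_tensor C _ m' D _ _ F s' X X' Y Y' f g
  have ha := @IsStrictMonoidal.map_associator C _ m D _ _ F s
  have ha' := @IsStrictMonoidal.map_associator C _ m' D _ _ F s'
  have hlu := @IsStrictMonoidal.map_leftUnitor C _ m D _ _ F s
  have hlu' := @IsStrictMonoidal.map_leftUnitor C _ m' D _ _ F s'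
  have hru := @IsStrictMonoidal.map_rightUnitor C _ m D _ _ F s
  have hru' := @IsStrictMonoidal.map_rightUnitor C _ m' D _ _ F s'
  have key : m.toMonoidalCategoryStruct = m'.toMonoidalCategoryStruct := by
    obtain @⟨⟨T, wl, wr, th, U, a, l, r⟩, _⟩ := m
    obtain @⟨⟨T', wl', wr', th', U', a', l', r'⟩, _⟩ := m'
    obtain rfl : T = T' := funext fun X => funext fun Y => hT X Y
    obtain rfl : U = U' := hU
    obtain rfl : @th = @th' := by
      funext X X' Y Y' f g
      -- With the objects identified, both strictness formulas have the same right-hand side, as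
      -- `eqToHom` does not depend on the proof of equality.
      exact F.map_injective ((ht f g).trans (ht' f g).symm)
    obtain rfl : @wl = @wl' := by
      funext X Y Y' f
      exact (hl X f).trans (hl' X f).symm
    obtain rfl : @wr = @wr' := by
      funext X X' f Y
      exact (hr f Y).trans (hr' f Y).symm
    obtain rfl : @a = @a' := by
      funext X Y Z
      exact Iso.ext (F.map_injective ((ha X Y Z).trans (ha' X Y Z).symm))
    obtain rfl : @l = @l' := by
      funext X
      exact Iso.ext (F.map_injective ((hlu X).trans (hlu' X).symm))
    obtain rfl : @r = @r' := by
      funext X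
      exact Iso.ext (F.map_injective ((hru X).trans (hru' X).symm))
    rfl
  clear hl hr hl' hr' ht ht' ha ha' hlu hlu' hru hru' s s' hT hU
  cases m
  cases m'
  cases key
  rfl

namespace AeRing

variable {k : Type v} [CommRing k] {A : Type u} [Ring A] [Algebra k A]
variable {H : Type u} [Ring H] [Algebra k H] {R : AeRing.{v, u} k A H}

/-- Here `X` fixes the carrier and its additive structure, and the orbit maps fix the action of `H`;
nothing else is left in an `H`-module. -/
theorem eq_of_orbit_eq {P Q : ModuleCat.{u} H} {X : ABimod.{v, u} k A}
    (hP : R.forget.obj P = X) (hQ : R.forget.obj Q = X)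
    (h : ∀ x : X, R.orbit P ((eqToIso hP).inv x) ≫ (eqToIso hP).hom =
      R.orbit Q ((eqToIso hQ).inv x) ≫ (eqToIso hQ).hom) : P = Q := by
  let E : R.forget.obj P = R.forget.obj Q := hP.trans hQ.symm
  have hE : ∀ x : R.forget.obj P, (eqToHom E) x = (eqToIso hQ).inv ((eqToIso hP).hom x) := by
    intro x
    change _ = (eqToHom hP ≫ eqToHom hQ.symm) x
    rw [eqToHom_trans]
  have hc : ∀ x : R.forget.obj P, (eqToHom E) x = cast (congrArg ABimod.carrier E) x :=
    ABimod.eqToHom_apply E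
  refine ModuleCat.eq_of_cast (congrArg ABimod.carrier E) (fun x y => ?_) fun c x => ?_
  · exact (hc _).symm.trans ((map_add (eqToHom E).lin _ _).trans
      (congrArg₂ (fun a b : R.forget.obj Q => a + b) (hc x) (hc y)))
  · have key : ∀ y : R.forget.obj P, (eqToHom E) (R.act P c y) = R.act Q c ((eqToHom E) y) := by
      intro y
      have e := AeBimod.hom_comm (h ((eqToIso hP).hom y)) c
      rw [ABimod.comp_apply, ABimod.comp_apply, ABimod.hom_inv_apply, ← hE, orbit_apply,
        orbit_apply] at e
      rw [hE, e, ABimod.hom_inv_apply]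
    exact (hc _).symm.trans ((key x).trans (congrArg (R.act Q c) (hc x)))

namespace AnchoredBialgebroid

/-- A bialgebroid with an anchor induces a lift of the monoidal structure if the actions on tensor
products and the unit object are given by its comultiplication and anchor. -/
def Induces (B : AnchoredBialgebroid R) (L : StrictMonoidalLift R) : Prop :=
  (∀ M N, R.IsTensorAction B.comul (L.tensorIso M N)) ∧ R.IsUnitAction B.anchor L.unitIso

theorem induces_toLift (B : AnchoredBialgebroid R) : B.Induces B.toLift :=
  ⟨B.tensorData.isTensorAction, B.tensorData.isUnitAction⟩

theorem induces_toAnchored (L : StrictMonoidalLift R) : L.toAnchored.Induces L :=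
  ⟨L.isTensorAction, L.isUnitAction⟩

/-- The value `Δ(h)` is visible as `h (1 ⊗ 1)` on the regular module, and `μ(h)(a)` as `h` acting on
`a` in the unit object. -/
theorem Induces.eq {B B' : AnchoredBialgebroid R} {L : StrictMonoidalLift R}
    (h : B.Induces L) (h' : B'.Induces L) : B = B' := by
  refine ext' ?_ fun x => LinearMap.ext fun a => ?_
  · rw [← cancel_mono (R.regIso.hom ⊗ₘ R.regIso.hom), ← (h.1 _ _).orbit_reg_one_comp,
      ← (h'.1 _ _).orbit_reg_one_comp]
  · exact AeBimod.hom_comm ((h.2 a).symm.trans (h'.2 a)) x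

/-- The pair `(Δ, μ)` determines the tensor and unit modules as objects; faithfulness of the
forgetful functor determines the rest. -/
theorem Induces.lift_eq {B : AnchoredBialgebroid R} {L L' : StrictMonoidalLift R}
    (h : B.Induces L) (h' : B.Induces L') : L = L' := by
  have hT : ∀ M N, L.tensorMod M N = L'.tensorMod M N := fun M N =>
    eq_of_orbit_eq (L.forget_tensorMod M N) (L'.forget_tensorMod M N)
      ((h.1 M N).orbit_eq (h'.1 M N))
  have hU : L.unitMod = L'.unitMod :=
    eq_of_orbit_eq L.forget_unitMod L'.forget_unitMod fun a => (h.2 a).trans (h'.2 a).symm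
  have hm : L.monoidal = L'.monoidal :=
    IsStrictMonoidal.monoidalCategory_eq R.forget L.monoidal L'.monoidal L.strict L'.strict hT hU
  cases L
  cases L'
  cases hm
  rfl

theorem Induces.isInducedBy {B : AnchoredBialgebroid R} {L : StrictMonoidalLift R}
    (h : B.Induces L) : @AeRing.IsInducedBy k _ A _ _ H _ _ R L.monoidal L.strict B.toTakeuchi :=
  ⟨fun M N m n x => AeBimod.hom_comm (h.1 M N m n) x, fun a x => AeBimod.hom_comm (h.2 a) x⟩

end AnchoredBialgebroid

/-- Structures of a bialgebroid with an anchor correspond to the lifts of the monoidal structure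
to the category of `H`-modules. -/
noncomputable def anchoredEquivLift (R : AeRing.{v, u} k A H) :
    R.AnchoredBialgebroid ≃ R.StrictMonoidalLift where
  toFun := AnchoredBialgebroid.toLift
  invFun := StrictMonoidalLift.toAnchored
  -- The reconstructed structure and `B` induce the same monoidal structure, hence agree; the other
  -- composite is settled in the same way by uniqueness of the lift.
  left_inv B := (AnchoredBialgebroid.induces_toAnchored B.toLift).eq B.induces_toLift
  right_inv L := L.toAnchored.induces_toLift.lift_eq (AnchoredBialgebroid.induces_toAnchored L)

end AeRing

/-- For an `A^e`-ring `(H, s, t)`, the four kinds of structures correspond bijectively to each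
other, by the explicit passages. -/
theorem theorem3p1 {k : Type v} [CommRing k] {A : Type u} [Ring A] [Algebra k A]
    {H : Type u} [Ring H] [Algebra k H] (R : AeRing.{v, u} k A H) :
    ∃ (e₁₂ : R.LuBialgebroid ≃ R.AnchoredBialgebroid)
      (e₂₃ : R.AnchoredBialgebroid ≃ R.TakeuchiBialgebra)
      (e₃₄ : R.TakeuchiBialgebra ≃ R.StrictMonoidalLift),
      (∀ B : R.LuBialgebroid, (e₁₂ B).comul = B.comul ∧
        ∀ (h : H) (a : A),
          (e₁₂ B).mu h a = B.eps (h * R.s a) ∧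
          (e₁₂ B).mu h a = B.eps (h * R.t (MulOpposite.op a))) ∧
      (∀ B : R.AnchoredBialgebroid, (e₁₂.symm B).comul = B.comul ∧
        ∀ h : H, (e₁₂.symm B).eps h = B.mu h 1) ∧
      (∀ (B : R.AnchoredBialgebroid) (h : H),
        ((e₂₃ B).comul h).1 = B.comul h ∧ (e₂₃ B).mu h = B.mu h) ∧
      (∀ B : R.TakeuchiBialgebra,
        @AeRing.IsInducedBy k _ A _ _ H _ _ R (e₃₄ B).monoidal (e₃₄ B).strict B) := by
  refine ⟨R.luEquivAnchored, R.anchoredEquivTakeuchi,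
    -- The bijection between (3) and (4) passes through (2).
    R.anchoredEquivTakeuchi.symm.trans R.anchoredEquivLift,
    fun B => ⟨rfl, fun h a => ⟨rfl, (B.eps_mul_t h a).symm⟩⟩, fun B => ⟨rfl, fun h => rfl⟩,
    fun B h => ⟨rfl, rfl⟩, fun B => ?_⟩
  have h := (R.anchoredEquivTakeuchi.symm B).induces_toLift.isInducedBy
  have e : (R.anchoredEquivTakeuchi.symm B).toTakeuchi = B :=
    R.anchoredEquivTakeuchi.apply_symm_apply B
  rw [e] at h
  exact h
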